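/- **Theorem (steering to Bayes-correlated equilibria).** Let $\hat\Gamma$ be a finite extensive-form game with players $1,\dots,n$, utilities in $[0,1]$ and set $\hat Z$ of terminal nodes. A player's *sequence* at a node is the set of its information sets on the path, with the actions played there. *Augmented game.* $\Gamma$ has one more player, the mediator (player $0$), who has perfect information. At a decision point of player $i$ the mediator may first recommend one of the legal actions; only $i$ observes the recommendation, and then $i$ acts. Whether a recommendation is given is decided by a fixed protocol from the list of the players who disobeyed a recommendation so far (listed once for each disobeyed recommendation) and from $i$. Players remember the recommendations they received. Let $Z$ be the set of terminal nodes of $\Gamma$, $X_i$ the polytope of sequence-form mixed strategies $x_i\in[0,1]^{\Sigma_i}$ of player $i$ in $\Gamma$ ($\Sigma_i$ is the set of sequences of $i$ at terminal nodes), $x_i[z]$ the entry of $x_i$ at the sequence of $i$ at $z$, $X=X_1\times\dots\times X_n$, and $\hat x[z]=\prod_{i=1}^n x_i[z]$. For $\mu\in X_0$ let $\Gamma^\mu$ be the $n$-player game in which the mediator is a chance player that plays $\mu$, let $\pi(z\mid x)$ be the probability that $x\in X$ reaches $z$ in $\Gamma^\mu$, and $u_i(x)=\sum_z\pi(z\mid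 x)u_i(z)$. A *direct* profile $d$ consists of pure strategies $d_i$ that follow every recommendation (and are arbitrary where none is given). $\mu$ is a *Bayes-correlated equilibrium* if $d$ is a Nash equilibrium of $\Gamma^\mu$. *Steering.* $\mu$ is fixed. In rounds $t=1,\dots,T$ the players play $x^{(t)}\in X$ and player $i$ is paid $p_i(x^{(t)})$. With $v_i^{(t)}(y)=u_i(y,x^{(t)}_{-i})+p_i(y,x^{(t)}_{-i})$ and payment bound $P$, the regret of $i$ is $\frac1{P+1}\bigl[\max_{y\in X_i}\sum_t v_i^{(t)}(y)-\sum_t v_i^{(t)}(x_i^{(t)})\bigr]$; it is assumed to be at most $R(T)$ for every $i$, where $R(T)>0$. The *average payment* to $i$ is $\frac1T\sum_t p_i(x^{(t)})$, the *directness gap* is $\sum_{z}\bigl|\frac1T\sum_t\hat x^{(t)}[z]-\hat d[z]\bigr|$, and the *outcome gap* is $\sum_{z}\bigl|\frac1T\sum_t\pi(z\mid x^{(t)})-\pi(z\mid d)\bigr|$. Let $\mu$ be any Bayes-correlated equilibrium, with direct profile $d$. Then: 1. *(Size.)* If the protocol gives no recommendation once two recommendations have been disobeyed, then $|Z|\le|\hat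 Z|^3$. 2. *(FullFeedbackSteer.)* Let $\epsilon=4nR(T)/T$, $\alpha=\sqrt\epsilon$, and let $$p_i(x)=\alpha\, d_i^\top x_i+\bigl[u_i(x_i,d_{-i})-u_i(x)\bigr]-\min_{y\in X_i}\bigl[u_i(y,d_{-i})-u_i(y,x_{-i})\bigr],\qquad P=3 .$$ If $T\ge 1$ and $\alpha\le1/|Z|$, then each $p_i$ has values in $[0,3]$ on $X$, is linear in $x_i\in X_i$ and continuous in $x_{-i}$, and the average payments, the directness gap and the outcome gap are all at most $3|Z|\sqrt\epsilon$. If $R(T)=o(T)$, all three tend to $0$ as $T\to\infty$. 3. *(TrajectorySteer.)* Let $\epsilon=R(T)/T$, $\alpha=4|Z|^{1/2}\epsilon^{1/4}$, $P=2|Z|^{1/2}\epsilon^{-1/4}$, and let $p_i(x)=\sum_z\pi(z\mid x)\,q_i(z)$ with $q_i(z)=\alpha\,\hat d[z]+P\,d_i[z]\,(1-\hat d[z])$. If $T\ge1$ and $\alpha\le1$, then $q_i(z)\in[0,P]$ for all $i,z$, the average payments are at most $8\,|\hat Z|\,|Z|^{1/2}\epsilon^{1/4}$, and the outcome gap is at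 most $2\,|\hat Z|\,\epsilon^{1/2}$. If $R(T)=o(T)$, both tend to $0$ as $T\to\infty$. -/

import Mathlib

/-- Finite game trees. `ι` is the set of players, `L` the set of labels of information sets and
`A I` the set of actions at the information set `I`. A leaf carries the utilities of the players,
a chance node a weight for each outcome, a decision node the information set it belongs to. -/
inductive GameTree (ι L : Type) (A : L → Type) : Type
  | leaf (u : ι → ℝ) : GameTree ι L A
  | chance (k : ℕ) (p : Fin k → ℝ) (child : Fin k → GameTree ι L A) : GameTree ι L A
  | decision (I : L) (child : A I → GameTree ι L A) : GameTree ι L A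

namespace GameTree

variable {ι L : Type} {A : L → Type}

/-- The terminal nodes of a tree, as paths from the root. -/
def Leaf : GameTree ι L A → Type
  | leaf _ => Unit
  | chance k _ c => Σ a : Fin k, (c a).Leaf
  | decision I c => Σ a : A I, (c a).Leaf

/-- A tree has finitely many terminal nodes. -/
@[reducible] noncomputable def leafFintype [∀ I, Fintype (A I)] : (t : GameTree ι L A) → Fintype t.Leaf
  | leaf _ => inferInstanceAs (Fintype Unit)
  | chance k _ c =>
      haveI : ∀ a, Fintype (c a).Leaf := fun a => leafFintype (c a)
      inferInstanceAs (Fintype (Σ a : Fin k, (c a).Leaf))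
  | decision I c =>
      haveI : ∀ a, Fintype (c a).Leaf := fun a => leafFintype (c a)
      inferInstanceAs (Fintype (Σ a : A I, (c a).Leaf))

/-- Utilities lie in `[0, 1]` and the weights at each chance node form a probability
distribution. -/
def WellFormed : GameTree ι L A → Prop
  | leaf u => ∀ i, 0 ≤ u i ∧ u i ≤ 1
  | chance _ p c => (∀ a, 0 ≤ p a) ∧ ∑ a, p a = 1 ∧ ∀ a, (c a).WellFormed
  | decision _ c => ∀ a, (c a).WellFormed

/-- The product of the probabilities of the chance moves on the path to a terminal node. -/
noncomputable def chanceProb : (t : GameTree ι L A) → t.Leaf → ℝ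
  | leaf _, _ => 1
  | chance _ p c, ⟨a, z⟩ => p a * chanceProb (c a) z
  | decision _ c, ⟨a, z⟩ => chanceProb (c a) z

/-- The utility of player `i` at a terminal node. -/
def payoff (i : ι) : (t : GameTree ι L A) → t.Leaf → ℝ
  | leaf u, _ => u i
  | chance _ _ c, ⟨a, z⟩ => payoff i (c a) z
  | decision _ c, ⟨a, z⟩ => payoff i (c a) z

/-- The sequence of player `i` at a terminal node: the set of all information sets of `i` met on
the path, each with the action played there. -/
def sequence (owner : L → ι) (i : ι) : (t : GameTree ι L A) → t.Leaf → Set (Σ I, A I)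
  | leaf _, _ => ∅
  | chance _ _ c, ⟨a, z⟩ => sequence owner i (c a) z
  | decision I c, ⟨a, z⟩ => {m | owner I = i ∧ m = ⟨I, a⟩} ∪ sequence owner i (c a) z

end GameTree

/-- Extensive-form games with set of players `ι`. An information set is the set of all nodes that
carry the same label; it has one owner and one (finite, nonempty) set of actions. -/
structure ExtensiveGame (ι : Type) where
  InfoSet : Type
  Action : InfoSet → Type
  [actionFintype : ∀ I, Fintype (Action I)]
  [actionNonempty : ∀ I, Nonempty (Action I)]
  owner : InfoSet → ι
  tree : GameTree ι InfoSet Action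
  wellFormed : tree.WellFormed

namespace ExtensiveGame

attribute [instance] ExtensiveGame.actionFintype ExtensiveGame.actionNonempty

section Basic

variable {ι : Type} (G : ExtensiveGame ι)

/-- The set `Z` of terminal nodes. -/
def Terminal : Type := G.tree.Leaf

noncomputable instance : Fintype G.Terminal := GameTree.leafFintype G.tree

/-- The probability that chance makes all its moves on the path to `z`. -/
noncomputable def chanceProb (z : G.Terminal) : ℝ := G.tree.chanceProb z

/-- The utility of player `i` at the terminal node `z`. -/
def payoff (i : ι) (z : G.Terminal) : ℝ := G.tree.payoff i z

/-- The sequence `σ_i(z)` of player `i` at `z`. -/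
def sequence (i : ι) (z : G.Terminal) : Set (Σ I, G.Action I) :=
  G.tree.sequence G.owner i z

/-- The set `Σ_i = {σ_i(z) : z ∈ Z}` of terminal sequences of player `i`. -/
def Seq (i : ι) : Type := Set.range (G.sequence i)

open Classical in
noncomputable instance (i : ι) : Fintype (G.Seq i) :=
  inferInstanceAs (Fintype (Set.range (G.sequence i)))

/-- A pure strategy of player `i`: an action at each of its information sets. -/
def PureStrategy (i : ι) : Type := ∀ I : {I // G.owner I = i}, G.Action I

open Classical in
/-- The sequence form of a pure strategy. -/
noncomputable def seqForm {i : ι} (s : G.PureStrategy i) : G.Seq i → ℝ := fun σ =>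
  if ∀ m ∈ σ.1, ∀ h : G.owner m.1 = i, s ⟨m.1, h⟩ = m.2 then 1 else 0

/-- The polytope `X_i` of sequence forms of mixed strategies of player `i`. -/
def strategies (i : ι) : Set (G.Seq i → ℝ) :=
  convexHull ℝ (Set.range (G.seqForm (i := i)))

/-- The entry `x_i[z] = x_i[σ_i(z)]`. -/
def entry {i : ι} (x : G.Seq i → ℝ) (z : G.Terminal) : ℝ :=
  x ⟨G.sequence i z, z, rfl⟩

end Basic

section Mediated

/-! Games with players `Option ι`, where `none` is the mediator. For a strategy `μ` of the
mediator, the game `Γ^μ` is the game among the players `ι` in which the mediator is a further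
chance player that plays `μ`. -/

variable {ι : Type} [Fintype ι] [DecidableEq ι] (G : ExtensiveGame (Option ι))

/-- Tuples with one vector on `Σ_i` for each player `i ∈ ι`. -/
abbrev Profile : Type := ∀ i : ι, G.Seq (some i) → ℝ

/-- The set `X = ∏ i, X_i` of strategy profiles of the players `ι`. -/
def profiles : Set G.Profile := {x | ∀ i, x i ∈ G.strategies (some i)}

/-- `x̂[z] = ∏ i, x_i[z]`, the product over the players `ι`. -/
noncomputable def hat (x : G.Profile) (z : G.Terminal) : ℝ := ∏ i, G.entry (x i) z

/-- The probability that `z` is reached in `Γ^μ` under the profile `x`. -/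
noncomputable def reach (μ : G.Seq none → ℝ) (x : G.Profile) (z : G.Terminal) : ℝ :=
  G.chanceProb z * G.entry μ z * G.hat x z

/-- The expected utility `u_i(μ, x)` of player `i`. -/
noncomputable def util (μ : G.Seq none → ℝ) (i : ι) (x : G.Profile) : ℝ :=
  ∑ z, G.reach μ x z * G.payoff (some i) z

/-- `x` is a Nash equilibrium of `Γ^μ`. -/
def IsNash (μ : G.Seq none → ℝ) (x : G.Profile) : Prop :=
  x ∈ G.profiles ∧ ∀ i, ∀ y ∈ G.strategies (some i),
    G.util μ i (Function.update x i y) ≤ G.util μ i x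

/-- The requirements on the payment function of player `i` in the steering problem: values in
`[0, P]`, linear in `x_i` (on the convex set `X_i`) and continuous in `x_{-i}`. -/
structure IsPaymentFunction (P : ℝ) (i : ι) (p : G.Profile → ℝ) : Prop where
  nonneg : ∀ x ∈ G.profiles, 0 ≤ p x
  le_bound : ∀ x ∈ G.profiles, p x ≤ P
  linear : ∀ x ∈ G.profiles, ∀ y ∈ G.strategies (some i), ∀ y' ∈ G.strategies (some i),
    ∀ a b : ℝ, 0 ≤ a → 0 ≤ b → a + b = 1 →
      p (Function.update x i (a • y + b • y')) =
        a * p (Function.update x i y) + b * p (Function.update x i y')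
  continuous : ∀ y ∈ G.strategies (some i),
    ContinuousOn (fun x => p (Function.update x i y)) G.profiles

/-- The regret of player `i` over rounds `0, …, T - 1` of play `x` in `Γ^μ` when each player `j`
receives `p j` on top of its utility; normalized by `1 / (P + 1)`. -/
noncomputable def regret (μ : G.Seq none → ℝ) (P : ℝ) (p : ι → G.Profile → ℝ) (T : ℕ)
    (x : ℕ → G.Profile) (i : ι) : ℝ :=
  1 / (P + 1) *
    ((⨆ y : G.strategies (some i), ∑ t ∈ Finset.range T,
        (G.util μ i (Function.update (x t) i y.1) + p i (Function.update (x t) i y.1)))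
      - ∑ t ∈ Finset.range T, (G.util μ i (x t) + p i (x t)))

/-- The time-averaged realized payment to player `i`. -/
noncomputable def avgPayment (p : ι → G.Profile → ℝ) (T : ℕ) (x : ℕ → G.Profile) (i : ι) : ℝ :=
  1 / (T : ℝ) * ∑ t ∈ Finset.range T, p i (x t)

/-- The directness gap `‖(1/T) ∑ x̂^(t) - d̂‖₁`. -/
noncomputable def directnessGap (d : G.Profile) (T : ℕ) (x : ℕ → G.Profile) : ℝ :=
  ∑ z, |1 / (T : ℝ) * ∑ t ∈ Finset.range T, G.hat (x t) z - G.hat d z|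

/-- The `ℓ₁` distance between the time-averaged outcome distribution of the play `x` over
terminal nodes in `Γ^μ` and the outcome distribution of `d`. -/
noncomputable def outcomeGap (μ : G.Seq none → ℝ) (d : G.Profile) (T : ℕ)
    (x : ℕ → G.Profile) : ℝ :=
  ∑ z, |1 / (T : ℝ) * ∑ t ∈ Finset.range T, G.reach μ (x t) z - G.reach μ d z|

/-- The payments of FullFeedbackSteer in `Γ^μ` with target `d`: directness bonus, sandboxing
payments, and a payment that ensures nonnegativity. -/
noncomputable def fullFeedbackPayment (μ : G.Seq none → ℝ) (d : G.Profile) (α : ℝ) (i : ι)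
    (x : G.Profile) : ℝ :=
  α * ∑ σ, d i σ * x i σ
    + (G.util μ i (Function.update d i (x i)) - G.util μ i x)
    - ⨅ y : G.strategies (some i),
        (G.util μ i (Function.update d i y.1) - G.util μ i (Function.update x i y.1))

/-- The payments of TrajectorySteer at terminal nodes: `α` to everyone if all players have been
direct, and otherwise `P` to those players who have been direct. -/
noncomputable def trajectoryPay (d : G.Profile) (α P : ℝ) (i : ι) (z : G.Terminal) : ℝ :=
  α * G.hat d z + P * G.entry (d i) z * (1 - G.hat d z)

/-- The expected payment of TrajectorySteer to player `i` in `Γ^μ` under the profile `x`. -/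
noncomputable def trajectoryPayment (μ : G.Seq none → ℝ) (d : G.Profile) (α P : ℝ) (i : ι)
    (x : G.Profile) : ℝ :=
  ∑ z, G.reach μ x z * G.trajectoryPay d α P i z

end Mediated

section Augmented

variable {ι : Type} [DecidableEq ι] (G : ExtensiveGame ι)

/-- The events that make up a history of the mediator-augmented game: an outcome of a chance node,
a recommendation of the mediator, an action of a player. -/
inductive AugEvent : Type
  | chance (a : ℕ)
  | advice (I : G.InfoSet) (a : G.Action I)
  | act (I : G.InfoSet) (a : G.Action I)

/-- The information sets of the mediator-augmented game. The mediator has perfect information: it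
knows the whole history. A player knows its information set `I` in the original game, what
recommendations (or `none`) it received at its earlier decision points, and the recommendation
(or `none`) that it receives now. -/
inductive AugInfoSet : Type
  | mediator (history : List G.AugEvent) (I : G.InfoSet)
  | player (I : G.InfoSet) (past : List (Option (Σ J, G.Action J))) (now : Option (G.Action I))

/-- In either case, the actions are those of the original information set. -/
def AugAction : G.AugInfoSet → Type
  | .mediator _ I => G.Action I
  | .player I _ _ => G.Action I

/-- The owner of an information set of the mediator-augmented game. -/
def augOwner : G.AugInfoSet → Option ι
  | .mediator _ _ => none
  | .player I _ _ => some (G.owner I)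

open Classical in
/-- The tree of the mediator-augmented game below a node of the original tree. Here `history` is
the list of events so far (latest first), `past i` the recommendations that player `i` has
received (latest first), and `dis` lists the player of each disobeyed recommendation so far
(latest first). The mediator gives a recommendation at a decision point of player `i` exactly if
`advise dis i` holds. -/
noncomputable def augTree (advise : List ι → ι → Prop) :
    GameTree ι G.InfoSet G.Action → List G.AugEvent →
      (ι → List (Option (Σ J, G.Action J))) → List ι →
      GameTree (Option ι) G.AugInfoSet G.AugAction
  | .leaf u, _, _, _ => .leaf fun j => j.elim 0 u
  | .chance k p c, history, past, dis =>
      .chance k p fun a => augTree advise (c a) (.chance a.1 :: history) past dis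
  | .decision I c, history, past, dis =>
      if advise dis (G.owner I) then
        .decision (.mediator history I) fun r : G.Action I =>
          .decision (.player I (past (G.owner I)) (some r)) fun a : G.Action I =>
            augTree advise (c a) (.act I a :: .advice I r :: history)
              (Function.update past (G.owner I) (some ⟨I, r⟩ :: past (G.owner I)))
              (if a = r then dis else G.owner I :: dis)
      else
        .decision (.player I (past (G.owner I)) none) fun a : G.Action I =>
          augTree advise (c a) (.act I a :: history)
            (Function.update past (G.owner I) (none :: past (G.owner I))) dis

theorem augTree_wellFormed (advise : List ι → ι → Prop) :
    ∀ (t : GameTree ι G.InfoSet G.Action), t.WellFormed →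
      ∀ (history : List G.AugEvent) (past : ι → List (Option (Σ J, G.Action J))) (dis : List ι),
        (G.augTree advise t history past dis).WellFormed := by
  intro t
  induction t with
  | leaf u =>
    intro h history past dis j
    cases j with
    | none => simp
    | some i => exact h i
  | chance k p c ih =>
    intro h history past dis
    exact ⟨h.1, h.2.1, fun a => ih a (h.2.2 a) _ _ _⟩
  | decision I c ih =>
    intro h history past dis
    unfold augTree
    split_ifs
    · exact fun r a => ih a (h a) _ _ _
    · exact fun a => ih a (h a) _ _ _

/-- The mediator-augmented game `Γ` of a game `Γ̂`. The mediator is the player `none`; its own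
utility plays no role and is set to `0`. -/
noncomputable def augment (advise : List ι → ι → Prop) : ExtensiveGame (Option ι) where
  InfoSet := G.AugInfoSet
  Action := G.AugAction
  actionFintype := fun
    | .mediator _ I => inferInstanceAs (Fintype (G.Action I))
    | .player I _ _ => inferInstanceAs (Fintype (G.Action I))
  actionNonempty := fun
    | .mediator _ I => inferInstanceAs (Nonempty (G.Action I))
    | .player I _ _ => inferInstanceAs (Nonempty (G.Action I))
  owner := G.augOwner
  tree := G.augTree advise G.tree [] (fun _ => []) []
  wellFormed := G.augTree_wellFormed advise G.tree G.wellFormed _ _ _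

/-- A pure strategy of player `i` in `Γ` is direct if it follows all recommendations. -/
def IsDirect (advise : List ι → ι → Prop) {i : ι}
    (s : (G.augment advise).PureStrategy (some i)) : Prop :=
  ∀ (I : G.InfoSet) (past : List (Option (Σ J, G.Action J))) (a : G.Action I)
    (h : G.augOwner (.player I past (some a)) = some i), s ⟨.player I past (some a), h⟩ = a

/-- `μ` is a Bayes-correlated equilibrium: a mediator strategy such that the direct profile `d`
is a Nash equilibrium of `Γ^μ`. -/
def IsBayesCorrelatedEquilibrium [Fintype ι] (advise : List ι → ι → Prop)
    (μ : (G.augment advise).Seq none → ℝ) (d : (G.augment advise).Profile) : Prop :=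
  μ ∈ (G.augment advise).strategies none ∧ (G.augment advise).IsNash μ d

end Augmented

end ExtensiveGame

/-! Both schemes rest on one comparison: in each round, let player `i` switch to `d i`. The payments
make the gain from this switch at least a multiple of some measure of how far the play is from `d`,
and the regret bound caps the gains summed over the rounds.

Full feedback. Up to a term that does not depend on `x_i`, the sandboxing payment replaces u_i(x) by
u_i(x_i, d_{-i}). Since `d` is a Nash equilibrium, the switch then gains at least α d_i·(d_i - x_i),
α times the shortfall of `i` (`fullFeedbackPayment_deviation`). So the total shortfall is on average
at most 4nR/(Tα) = √ε. The shortfall bounds every entry |d_i[z] - x_i[z]|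
(`abs_entry_sub_le_shortfall`), hence the change of x̂[z], of the utilities and of the payments.

Trajectories. The probability that `i` deviates is split into a sole part, where the others would be
direct once `i` is replaced by d_i, and a joint part. The switch raises the payment by exactly
α·sole_i + P·joint_i (`trajectoryPayment_deviation`) and lowers the utility by at most the sum of
all joint parts (`util_deviation`). Only players with a real choice matter, and there are fewer of
them than terminal nodes of the original game (`card_active_lt`). Summed over these players, the
utility losses are absorbed by the P·joint terms, which leaves α times the total deviation.

The bound on the utility loss is the combinatorial core (`GameTree.joint_deviation_le`). For two
pure profiles with the same mediator and the same chance moves, the two paths are common up to one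
node, whose owner is the first to deviate; a case distinction on this owner and a union bound
suffice. All quantities are affine in the strategy of each player and of the mediator, so the mixed
case reduces to the pure one (`weigh_nonneg_of_pure`).

Size. Induction on the tree with a budget of disobediences: each unit of the budget costs one more
factor of the number of original terminal nodes (`card_augTree_le`). -/

set_option linter.unusedSectionVars false

/-! ### Paths in a tree that obey a rule of action. -/

namespace GameTree

variable {ι L : Type} {A : L → Type}

attribute [local instance] GameTree.leafFintype

open Classical in
/-- Whether all moves of player `i` on the path to `z` are the ones that `f` prescribes. -/
noncomputable def agree (owner : L → ι) (i : ι) (f : ∀ I, A I) (t : GameTree ι L A)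
    (z : t.Leaf) : ℝ :=
  if ∀ m ∈ sequence owner i t z, f m.1 = m.2 then 1 else 0

open Classical in
/-- Whether all moves on the path to `z`, except those of chance, are the ones that `f`
prescribes. -/
noncomputable def follow (f : ∀ I, A I) : (t : GameTree ι L A) → t.Leaf → ℝ
  | leaf _, _ => 1
  | chance _ _ c, ⟨a, z⟩ => follow f (c a) z
  | decision I c, ⟨a, z⟩ => if f I = a then follow f (c a) z else 0

theorem agree_leaf (owner : L → ι) (i : ι) (f : ∀ I, A I) (u : ι → ℝ) (z) :
    agree owner i f (leaf u) z = 1 := by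
  simp [agree, sequence]

theorem agree_chance (owner : L → ι) (i : ι) (f : ∀ I, A I) (k : ℕ) (p : Fin k → ℝ)
    (c : Fin k → GameTree ι L A) (a) (z : (c a).Leaf) :
    agree owner i f (chance k p c) ⟨a, z⟩ = agree owner i f (c a) z := rfl

open Classical in
theorem agree_decision (owner : L → ι) (i : ι) (f : ∀ I, A I) (I : L)
    (c : A I → GameTree ι L A) (a) (z : (c a).Leaf) :
    agree owner i f (decision I c) ⟨a, z⟩ =
      if owner I = i ∧ f I ≠ a then 0 else agree owner i f (c a) z := by
  unfold agree
  have : (∀ m ∈ sequence owner i (decision I c) ⟨a, z⟩, f m.1 = m.2) ↔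
      (owner I = i → f I = a) ∧ ∀ m ∈ sequence owner i (c a) z, f m.1 = m.2 := by
    simp only [sequence, Set.mem_union, Set.mem_ofPred_eq]
    constructor
    · intro h
      exact ⟨fun hI => h ⟨I, a⟩ (Or.inl ⟨hI, rfl⟩), fun m hm => h m (Or.inr hm)⟩
    · rintro ⟨h₁, h₂⟩ m (⟨hI, rfl⟩ | hm)
      · exact h₁ hI
      · exact h₂ m hm
  rw [if_congr this rfl rfl]
  by_cases h₁ : owner I = i <;> by_cases h₂ : f I = a <;> simp [h₁, h₂]

theorem agree_nonneg (owner : L → ι) (i : ι) (f : ∀ I, A I) (t : GameTree ι L A) (z) :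
    0 ≤ agree owner i f t z := by
  unfold agree; split_ifs <;> norm_num

theorem agree_le_one (owner : L → ι) (i : ι) (f : ∀ I, A I) (t : GameTree ι L A) (z) :
    agree owner i f t z ≤ 1 := by
  unfold agree; split_ifs <;> norm_num

theorem follow_nonneg (f : ∀ I, A I) (t : GameTree ι L A) (z) : 0 ≤ follow f t z := by
  induction t with
  | leaf u => exact zero_le_one
  | chance k p c ih => exact ih _ _
  | decision I c ih =>
    obtain ⟨a, z⟩ := z
    simp only [follow]
    split_ifs
    · exact ih _ _
    · exact le_rfl

theorem prod_agree [Fintype ι] (owner : L → ι) (f : ∀ I, A I) (t : GameTree ι L A) (z) :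
    ∏ i, agree owner i f t z = follow f t z := by
  classical
  induction t with
  | leaf u => simp [agree_leaf, follow]
  | chance k p c ih => exact ih _ _
  | decision I c ih =>
    obtain ⟨a, z⟩ := z
    simp only [agree_decision, follow]
    split_ifs with h
    · simpa [h] using ih a z
    · exact Finset.prod_eq_zero (Finset.mem_univ (owner I)) (by simp [h])

theorem chanceProb_nonneg (t : GameTree ι L A) (ht : t.WellFormed) (z) : 0 ≤ chanceProb t z := by
  induction t with
  | leaf u => exact zero_le_one
  | chance k p c ih => exact mul_nonneg (ht.1 _) (ih _ (ht.2.2 _) _)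
  | decision I c ih => exact ih _ (ht _) _

theorem chanceProb_le_one (t : GameTree ι L A) (ht : t.WellFormed) (z) : chanceProb t z ≤ 1 := by
  induction t with
  | leaf u => exact le_rfl
  | chance k p c ih =>
    refine mul_le_one₀ ?_ (chanceProb_nonneg _ (ht.2.2 _) _) (ih _ (ht.2.2 _) _)
    exact ht.2.1 ▸ Finset.single_le_sum (fun a _ => ht.1 a) (Finset.mem_univ _)
  | decision I c ih => exact ih _ (ht _) _

theorem payoff_mem (t : GameTree ι L A) (ht : t.WellFormed) (i : ι) (z) :
    0 ≤ payoff i t z ∧ payoff i t z ≤ 1 := by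
  induction t with
  | leaf u => exact ht i
  | chance k p c ih => exact ih _ (ht.2.2 _) _
  | decision I c ih => exact ih _ (ht _) _

/-- A path along which all decisions are made by `f`. -/
theorem exists_follow (f : ∀ I, A I) (t : GameTree ι L A) (ht : t.WellFormed) :
    ∃ z, ∀ (owner : L → ι) (i : ι), agree owner i f t z = 1 := by
  induction t with
  | leaf u => exact ⟨(), fun owner i => agree_leaf owner i f u _⟩
  | chance k p c ih =>
    have : Nonempty (Fin k) := by
      by_contra h
      rw [not_nonempty_iff] at h
      have := ht.2.1
      simp at this
    obtain ⟨a⟩ := this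
    obtain ⟨z, hz⟩ := ih a (ht.2.2 a)
    exact ⟨⟨a, z⟩, hz⟩
  | decision I c ih =>
    obtain ⟨z, hz⟩ := ih (f I) (ht _)
    refine ⟨⟨f I, z⟩, fun owner i => ?_⟩
    rw [agree_decision]
    simpa using hz owner i

/-- If a path agrees with `g` but not with `f`, then some path agrees with `f` but not
with `g`. -/
theorem exists_agree_of_not (owner : L → ι) (i : ι) (f g : ∀ I, A I) (t : GameTree ι L A)
    (ht : t.WellFormed) (z : t.Leaf) (hg : agree owner i g t z = 1)
    (hf : agree owner i f t z = 0) :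
    ∃ z', agree owner i f t z' = 1 ∧ agree owner i g t z' = 0 := by
  induction t with
  | leaf u => simp [agree_leaf] at hf
  | chance k p c ih =>
    obtain ⟨a, z⟩ := z
    obtain ⟨z', h⟩ := ih a (ht.2.2 a) z hg hf
    exact ⟨⟨a, z'⟩, h⟩
  | decision I c ih =>
    obtain ⟨a, z⟩ := z
    rw [agree_decision] at hf hg
    have hga : ¬ (owner I = i ∧ g I ≠ a) := fun h => by simp [h] at hg
    rw [if_neg hga] at hg
    -- At the first move of `i` on the path that `f` rejects, leave the path with the action of `f`
    -- and let `f` make all later decisions. The rule `g` prescribes the abandoned action `a`, so it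
    -- disagrees with the new path.
    by_cases hfa : owner I = i ∧ f I ≠ a
    · obtain ⟨z', hz'⟩ := exists_follow f (c (f I)) (ht _)
      refine ⟨⟨f I, z'⟩, ?_, ?_⟩
      · rw [agree_decision]
        simpa using hz' owner i
      · rw [agree_decision, if_pos]
        refine ⟨hfa.1, fun h => hga ⟨hfa.1, h ▸ hfa.2⟩⟩
    · rw [if_neg hfa] at hf
      obtain ⟨z', h₁, h₂⟩ := ih a (ht a) z hg hf
      refine ⟨⟨a, z'⟩, ?_, ?_⟩
      · rw [agree_decision, if_neg hfa, h₁]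
      · rw [agree_decision, if_neg hga, h₂]

/-! ### Expectations under a rule of action, and the splitting of two paths. -/

section Expect

variable [∀ I, Fintype (A I)]

/-- The expectation of `φ` over the terminal nodes when all decisions are made by `f`. -/
noncomputable def expect (f : ∀ I, A I) (t : GameTree ι L A) (φ : t.Leaf → ℝ) : ℝ :=
  ∑ z, chanceProb t z * follow f t z * φ z

theorem expect_leaf (f : ∀ I, A I) (u : ι → ℝ) (φ) : expect f (leaf u) φ = φ () := by
  simp only [expect]
  refine (Fintype.sum_unique (ι := Unit) _).trans ?_
  simp only [chanceProb, follow, one_mul]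

theorem expect_chance (f : ∀ I, A I) (k : ℕ) (p : Fin k → ℝ) (c : Fin k → GameTree ι L A) (φ) :
    expect f (chance k p c) φ = ∑ a, p a * expect f (c a) fun z => φ ⟨a, z⟩ := by
  simp only [expect, Finset.mul_sum]
  refine (Fintype.sum_sigma (α := fun a => (c a).Leaf) _).trans ?_
  refine Finset.sum_congr rfl fun a _ => Finset.sum_congr rfl fun z _ => ?_
  simp only [chanceProb, follow, mul_assoc]

theorem expect_decision (f : ∀ I, A I) (I : L) (c : A I → GameTree ι L A) (φ) :
    expect f (decision I c) φ = expect f (c (f I)) fun z => φ ⟨f I, z⟩ := by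
  simp only [expect]
  refine (Fintype.sum_sigma (α := fun a => (c a).Leaf) _).trans ?_
  rw [Finset.sum_eq_single (f I)]
  · refine Finset.sum_congr rfl fun z _ => ?_
    simp only [chanceProb, follow, if_true]
  · intro a _ ha
    refine Finset.sum_eq_zero fun z _ => ?_
    simp only [follow, if_neg ha.symm, mul_zero, zero_mul]
  · simp

theorem expect_mono (f : ∀ I, A I) (t : GameTree ι L A) (ht : t.WellFormed) {φ ψ : t.Leaf → ℝ}
    (h : ∀ z, φ z ≤ ψ z) : expect f t φ ≤ expect f t ψ :=
  Finset.sum_le_sum fun z _ => mul_le_mul_of_nonneg_left (h z)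
    (mul_nonneg (chanceProb_nonneg t ht z) (follow_nonneg f t z))

theorem expect_sub (f : ∀ I, A I) (t : GameTree ι L A) (φ ψ : t.Leaf → ℝ) :
    expect f t (fun z => φ z - ψ z) = expect f t φ - expect f t ψ := by
  simp only [expect, mul_sub, Finset.sum_sub_distrib]

theorem expect_sum {κ : Type*} (s : Finset κ) (f : ∀ I, A I) (t : GameTree ι L A)
    (φ : κ → t.Leaf → ℝ) :
    expect f t (fun z => ∑ k ∈ s, φ k z) = ∑ k ∈ s, expect f t (φ k) := by
  simp only [expect, Finset.mul_sum]
  exact Finset.sum_comm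

theorem expect_one (f : ∀ I, A I) (t : GameTree ι L A) (ht : t.WellFormed) :
    expect f t (fun _ => 1) = 1 := by
  induction t with
  | leaf u => rw [expect_leaf]
  | chance k p c ih =>
    rw [expect_chance, Finset.sum_congr rfl fun a _ => by rw [ih a (ht.2.2 a), mul_one], ht.2.1]
  | decision I c ih => rw [expect_decision]; exact ih _ (ht _)

theorem expect_zero (f : ∀ I, A I) (t : GameTree ι L A) : expect f t (fun _ => 0) = 0 := by
  simp [expect]

/-- Union bound, for events of probability `1 - x k`. -/
theorem one_sub_prod_le {κ : Type*} (s : Finset κ) (x : κ → ℝ) (h0 : ∀ k, 0 ≤ x k)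
    (h1 : ∀ k, x k ≤ 1) : 1 - ∏ k ∈ s, x k ≤ ∑ k ∈ s, (1 - x k) := by
  classical
  induction s using Finset.induction_on with
  | empty => simp
  | insert a s ha ih =>
    rw [Finset.prod_insert ha, Finset.sum_insert ha]
    have hp0 : 0 ≤ ∏ k ∈ s, x k := Finset.prod_nonneg fun k _ => h0 k
    have hp1 : ∏ k ∈ s, x k ≤ 1 := Finset.prod_le_one (fun k _ => h0 k) fun k _ => h1 k
    nlinarith [h1 a, h0 a]

/-- The probability that two players deviate, on the path of `d` or on the path of `f`, is
controlled by the probabilities with which a player's own deviation adds to the deviation of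
others. -/
theorem joint_deviation_le [DecidableEq ι] (owner : L → ι) (S : Finset ι) (d f : ∀ I, A I)
    (hS : ∀ I, owner I ∉ S → d I = f I) {i : ι} (hi : i ∈ S) (t : GameTree ι L A)
    (ht : t.WellFormed) :
    expect d t (fun z => (1 - agree owner i f t z) *
        (1 - ∏ k ∈ S.erase i, agree owner k f t z)) +
      expect f t (fun z => (1 - agree owner i d t z) *
        (1 - ∏ k ∈ S.erase i, agree owner k d t z)) ≤
    ∑ k ∈ S, (expect f t (fun z => 1 - agree owner k d t z) -
      expect d t (fun z => ∏ l ∈ S.erase k, agree owner l f t z -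
        ∏ l ∈ S, agree owner l f t z)) := by
  induction t with
  | leaf u => simp [expect_leaf, agree_leaf]
  | chance k p c ih =>
    simp only [expect_chance, agree_chance]
    simp only [← Finset.sum_add_distrib, ← Finset.sum_sub_distrib]
    rw [Finset.sum_comm]
    refine Finset.sum_le_sum fun a _ => ?_
    have := mul_le_mul_of_nonneg_left (ih a (ht.2.2 a)) (ht.1 a)
    simp only [← mul_sub, ← mul_add, ← Finset.mul_sum]
    exact this
  | decision I c ih =>
    -- While `d` and `f` choose alike, the two paths are the same and nothing is recorded.
    by_cases hI : d I = f I
    · have key := ih (d I) (ht _)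
      have h₁ : ∀ k (z : (c (d I)).Leaf), agree owner k f (decision I c) ⟨d I, z⟩ =
          agree owner k f (c (d I)) z := fun k z => by
        rw [agree_decision, if_neg (fun h => h.2 hI.symm)]
      have h₂ : ∀ k (z : (c (d I)).Leaf), agree owner k d (decision I c) ⟨d I, z⟩ =
          agree owner k d (c (d I)) z := fun k z => by
        rw [agree_decision, if_neg (fun h => h.2 rfl)]
      simp only [expect_decision]
      rw [← hI]
      simp only [h₁, h₂]
      exact key
    -- The paths split here. From now on the owner of `I` counts as deviating on both of them, so
    -- every product that includes this owner vanishes, whatever happens below.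
    · have hj : owner I ∈ S := by by_contra h; exact hI (hS I h)
      simp only [expect_decision]
      have zf : ∀ z : (c (d I)).Leaf,
          agree owner (owner I) f (decision I c) ⟨d I, z⟩ = 0 := fun z => by
        rw [agree_decision, if_pos ⟨rfl, fun h => hI h.symm⟩]
      have zd : ∀ z : (c (f I)).Leaf,
          agree owner (owner I) d (decision I c) ⟨f I, z⟩ = 0 := fun z => by
        rw [agree_decision, if_pos ⟨rfl, hI⟩]
      generalize hX : (fun k (z : (c (d I)).Leaf) =>
        agree owner k f (decision I c) ⟨d I, z⟩) = X
      generalize hY : (fun k (z : (c (f I)).Leaf) =>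
        agree owner k d (decision I c) ⟨f I, z⟩) = Y
      have eX : ∀ k z, agree owner k f (decision I c) ⟨d I, z⟩ = X k z := fun k z => by rw [← hX]
      have eY : ∀ k z, agree owner k d (decision I c) ⟨f I, z⟩ = Y k z := fun k z => by rw [← hY]
      have X0 : ∀ k z, 0 ≤ X k z := fun k z => eX k z ▸ agree_nonneg _ _ _ _ _
      have X1 : ∀ k z, X k z ≤ 1 := fun k z => eX k z ▸ agree_le_one _ _ _ _ _
      have Y0 : ∀ k z, 0 ≤ Y k z := fun k z => eY k z ▸ agree_nonneg _ _ _ _ _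
      have Y1 : ∀ k z, Y k z ≤ 1 := fun k z => eY k z ▸ agree_le_one _ _ _ _ _
      simp only [eX] at zf
      simp only [eY] at zd
      simp only [eX, eY]
      have one_d := expect_one d (c (d I)) (ht _)
      have one_f := expect_one f (c (f I)) (ht _)
      have pX : ∀ z, ∏ l ∈ S, X l z = 0 := fun z => Finset.prod_eq_zero hj (zf z)
      have pXe : ∀ k, k ≠ owner I → ∀ z, ∏ l ∈ S.erase k, X l z = 0 := fun k hk z =>
        Finset.prod_eq_zero (Finset.mem_erase.2 ⟨hk.symm, hj⟩) (zf z)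
      have pYe : ∀ k, k ≠ owner I → ∀ z, ∏ l ∈ S.erase k, Y l z = 0 := fun k hk z =>
        Finset.prod_eq_zero (Finset.mem_erase.2 ⟨hk.symm, hj⟩) (zd z)
      have other : ∀ k ∈ S.erase (owner I),
          expect f (c (f I)) (fun z => 1 - Y k z) -
            expect d (c (d I)) (fun z => ∏ l ∈ S.erase k, X l z - ∏ l ∈ S, X l z) =
          expect f (c (f I)) (fun z => 1 - Y k z) := fun k hk => by
        simp only [pX, pXe k (Finset.ne_of_mem_erase hk), sub_zero, expect_zero]
      rw [← Finset.add_sum_erase S _ hj, Finset.sum_congr rfl other]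
      simp only [zd, pX, sub_zero]
      rw [one_f]
      by_cases hij : i = owner I
      -- If `i` is the one who splits the paths, the term for `d` on the left cancels against the
      -- summand of `i`, and the term for `f` is handled by the union bound over the others.
      · subst hij
        simp only [zf, zd, sub_zero, one_mul]
        rw [expect_sub, one_d]
        have := expect_mono f (c (f I)) (ht _) (φ := fun z => 1 - ∏ k ∈ S.erase (owner I), Y k z)
          (ψ := fun z => ∑ k ∈ S.erase (owner I), (1 - Y k z)) fun z =>
            one_sub_prod_le _ (fun k => Y k z) (fun k => Y0 k z) (fun k => Y1 k z)
        rw [expect_sum] at this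
        linarith
      -- Otherwise the others of `i` include the owner of `I`, and the left side is just the
      -- probability that `i` deviates on each path. On the path of `f` this is a single summand; on
      -- the path of `d` it is at most the probability that some player besides the owner deviates.
      · simp only [pXe i hij, pYe i hij, sub_zero, mul_one]
        have hiS : i ∈ S.erase (owner I) := Finset.mem_erase.2 ⟨hij, hi⟩
        have h₁ := Finset.single_le_sum (s := S.erase (owner I))
          (f := fun k => expect f (c (f I)) (fun z => 1 - Y k z))
          (fun k _ => by
            rw [← expect_zero f (c (f I))]
            exact expect_mono f _ (ht _) fun z => sub_nonneg.2 (Y1 k z)) hiS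
        have h₂ := expect_mono d (c (d I)) (ht _)
          (φ := fun z => ∏ l ∈ S.erase (owner I), X l z) (ψ := fun z => X i z) fun z => by
            rw [← Finset.mul_prod_erase _ _ hiS]
            exact mul_le_of_le_one_right (X0 i z)
              (Finset.prod_le_one (fun k _ => X0 k z) fun k _ => X1 k z)
        rw [expect_sub d, one_d]
        linarith

end Expect

end GameTree

/-! ### Sequence-form strategies and the shortfall. -/

namespace ExtensiveGame

section Strategies

variable {κ : Type} (G : ExtensiveGame κ)

theorem convex_setOf_nonneg {E : Type*} [AddCommGroup E] [Module ℝ E] (F : E → ℝ)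
    (hF : ∀ y y' a b, a + b = 1 → F (a • y + b • y') = a * F y + b * F y') :
    Convex ℝ {y | 0 ≤ F y} := by
  intro y hy y' hy' a b ha hb hab
  have h₁ : 0 ≤ F y := hy
  have h₂ : 0 ≤ F y' := hy'
  change 0 ≤ F _
  rw [hF y y' a b hab]
  positivity

/-- A half-space that contains the generators of a convex hull contains the hull. This is the tool
for passing from pure to mixed strategies of one player. -/
theorem nonneg_of_seqForm {i : κ} (F : (G.Seq i → ℝ) → ℝ)
    (hF : ∀ y y' a b, a + b = 1 → F (a • y + b • y') = a * F y + b * F y')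
    (h : ∀ s : G.PureStrategy i, 0 ≤ F (G.seqForm s)) {x : G.Seq i → ℝ}
    (hx : x ∈ G.strategies i) : 0 ≤ F x :=
  convexHull_min (by rintro _ ⟨s, rfl⟩; exact h s) (convex_setOf_nonneg F hF) hx

theorem seqForm_mem {i : κ} (s : G.PureStrategy i) : G.seqForm s ∈ G.strategies i :=
  subset_convexHull _ _ ⟨s, rfl⟩

theorem seqForm_eq_zero_or_one {i : κ} (s : G.PureStrategy i) (σ : G.Seq i) :
    G.seqForm s σ = 0 ∨ G.seqForm s σ = 1 := by
  unfold seqForm; split_ifs <;> simp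

/-- A sequence of `i` contains only information sets owned by `i`, so a pure strategy may be
replaced by any rule on all information sets that extends it. -/
theorem entry_eq_agree {i : κ} (s : G.PureStrategy i) (f : ∀ I, G.Action I)
    (hf : ∀ I (h : G.owner I = i), f I = s ⟨I, h⟩) (z : G.Terminal) :
    G.entry (G.seqForm s) z = G.tree.agree G.owner i f z := by
  have owner_of_mem : ∀ (t : GameTree κ G.InfoSet G.Action) (z : t.Leaf),
      ∀ m ∈ t.sequence G.owner i z, G.owner m.1 = i := by
    intro t
    induction t with
    | leaf u => intro z m hm; exact hm.elim
    | chance k p c ih => rintro ⟨a, z⟩ m hm; exact ih a z m hm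
    | decision I c ih =>
      rintro ⟨a, z⟩ m (⟨h, rfl⟩ | hm)
      · exact h
      · exact ih a z m hm
  classical
  unfold entry seqForm GameTree.agree
  refine if_congr (forall₂_congr fun m hm => ?_) rfl rfl
  have h := owner_of_mem _ _ m hm
  rw [hf _ h]
  exact ⟨fun h' => h' h, fun h' _ => h'⟩

theorem mem_Icc_of_mem_strategies {i : κ} {x : G.Seq i → ℝ} (hx : x ∈ G.strategies i)
    (σ : G.Seq i) : 0 ≤ x σ ∧ x σ ≤ 1 := by
  constructor
  · refine G.nonneg_of_seqForm (fun x => x σ) (fun y y' a b _ => by simp) (fun s => ?_) hx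
    rcases G.seqForm_eq_zero_or_one s σ with h | h <;> simp [h]
  · have := G.nonneg_of_seqForm (fun x => 1 - x σ)
      (fun y y' a b h => by simp; linear_combination -h) (fun s => ?_) hx
    · simpa using this
    · rcases G.seqForm_eq_zero_or_one s σ with h | h <;> simp [h]

theorem entry_combination {i : κ} (a b : ℝ) (y y' : G.Seq i → ℝ) (z : G.Terminal) :
    G.entry (a • y + b • y') z = a * G.entry y z + b * G.entry y' z := rfl

theorem entry_nonneg {i : κ} {x : G.Seq i → ℝ} (hx : x ∈ G.strategies i) (z : G.Terminal) :
    0 ≤ G.entry x z := (G.mem_Icc_of_mem_strategies hx _).1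

theorem entry_le_one {i : κ} {x : G.Seq i → ℝ} (hx : x ∈ G.strategies i) (z : G.Terminal) :
    G.entry x z ≤ 1 := (G.mem_Icc_of_mem_strategies hx _).2

/-- There may be infinitely many information sets, hence infinitely many pure strategies. Their
sequence forms are nevertheless 0/1 vectors on a finite set, so the hull has finitely many
generators. -/
theorem isCompact_strategies (i : κ) : IsCompact (G.strategies i) := by
  refine Set.Finite.isCompact_convexHull ℝ (s := Set.range (G.seqForm (i := i))) ?_
  refine (Set.Finite.pi' (t := fun _ => ({0, 1} : Set ℝ)) fun _ => Set.toFinite _).subset ?_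
  rintro _ ⟨s, rfl⟩ σ
  exact G.seqForm_eq_zero_or_one s σ

theorem strategies_nonempty (i : κ) : (G.strategies i).Nonempty :=
  ⟨_, G.seqForm_mem fun I => Classical.arbitrary (G.Action I)⟩

theorem card_seq_le (i : κ) : Fintype.card (G.Seq i) ≤ Fintype.card G.Terminal :=
  Fintype.card_le_of_surjective (fun z => (⟨G.sequence i z, z, rfl⟩ : G.Seq i))
    (by rintro ⟨_, z, rfl⟩; exact ⟨z, rfl⟩)

theorem chanceProb_mem (z : G.Terminal) : 0 ≤ G.chanceProb z ∧ G.chanceProb z ≤ 1 :=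
  ⟨GameTree.chanceProb_nonneg _ G.wellFormed z, GameTree.chanceProb_le_one _ G.wellFormed z⟩

theorem payoff_mem (i : κ) (z : G.Terminal) : 0 ≤ G.payoff i z ∧ G.payoff i z ≤ 1 :=
  GameTree.payoff_mem _ G.wellFormed i z

theorem nonempty_terminal : Nonempty G.Terminal :=
  (GameTree.exists_follow (fun I => Classical.arbitrary (G.Action I)) _ G.wellFormed).nonempty

/-- The weight `d · (d - x)` that `x` takes away from the sequences played by `d`. -/
noncomputable def shortfall {i : κ} (d x : G.Seq i → ℝ) : ℝ := ∑ σ, d σ * (d σ - x σ)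

theorem shortfall_term_nonneg {i : κ} (s : G.PureStrategy i) {x : G.Seq i → ℝ}
    (hx : x ∈ G.strategies i) (σ : G.Seq i) :
    0 ≤ G.seqForm s σ * (G.seqForm s σ - x σ) := by
  rcases G.seqForm_eq_zero_or_one s σ with h | h <;> rw [h]
  · simp
  · linarith [(G.mem_Icc_of_mem_strategies hx σ).2]

theorem shortfall_nonneg {i : κ} (s : G.PureStrategy i) {x : G.Seq i → ℝ}
    (hx : x ∈ G.strategies i) : 0 ≤ G.shortfall (G.seqForm s) x :=
  Finset.sum_nonneg fun σ _ => G.shortfall_term_nonneg s hx σ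

theorem shortfall_affine {i : κ} (d : G.Seq i → ℝ) (y y' : G.Seq i → ℝ) (a b : ℝ)
    (h : a + b = 1) :
    G.shortfall d (a • y + b • y') = a * G.shortfall d y + b * G.shortfall d y' := by
  simp only [shortfall, Finset.mul_sum, ← Finset.sum_add_distrib]
  refine Finset.sum_congr rfl fun σ _ => ?_
  simp
  linear_combination -(d σ ^ 2) * h

/-- If `d[z] = 1`, the difference is itself a summand of the shortfall. If `d[z] = 0`, the claim is
affine in `x`, so `x` may be taken pure; when it also plays towards `z`,
`GameTree.exists_agree_of_not` yields a terminal node `z'` with `d[z'] = 1` and `x[z'] = 0`, whose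
sequence contributes 1 to the shortfall. -/
theorem abs_entry_sub_le_shortfall {i : κ} (s : G.PureStrategy i) {x : G.Seq i → ℝ}
    (hx : x ∈ G.strategies i) (z : G.Terminal) :
    |G.entry (G.seqForm s) z - G.entry x z| ≤ G.shortfall (G.seqForm s) x := by
  classical
  have single : ∀ {x : G.Seq i → ℝ}, x ∈ G.strategies i → ∀ z : G.Terminal,
      G.entry (G.seqForm s) z * (G.entry (G.seqForm s) z - G.entry x z) ≤
        G.shortfall (G.seqForm s) x := fun hx z =>
    Finset.single_le_sum (f := fun σ => G.seqForm s σ * (G.seqForm s σ - _))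
      (fun σ _ => G.shortfall_term_nonneg s hx σ) (Finset.mem_univ _)
  rcases G.seqForm_eq_zero_or_one s ⟨G.sequence i z, z, rfl⟩ with h | h
  · replace h : G.entry (G.seqForm s) z = 0 := h
    rw [h, zero_sub, abs_neg, abs_of_nonneg (G.entry_nonneg hx z)]
    have := G.nonneg_of_seqForm (fun x => G.shortfall (G.seqForm s) x - G.entry x z)
      (fun y y' a b hab => by
        rw [G.shortfall_affine _ _ _ _ _ hab]; rw [entry_combination]; ring) (fun g => ?_) hx
    · exact sub_nonneg.1 this
    rw [sub_nonneg]
    rcases G.seqForm_eq_zero_or_one g ⟨G.sequence i z, z, rfl⟩ with hg | hg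
    · replace hg : G.entry (G.seqForm g) z = 0 := hg
      rw [hg]
      exact G.shortfall_nonneg s (G.seqForm_mem g)
    · replace hg : G.entry (G.seqForm g) z = 1 := hg
      rw [hg]
      have ext : ∀ r : G.PureStrategy i, ∃ f : ∀ I, G.Action I,
          ∀ I (h : G.owner I = i), f I = r ⟨I, h⟩ := fun r =>
        ⟨fun I => if h : G.owner I = i then r ⟨I, h⟩ else Classical.arbitrary _,
          fun I h => dif_pos h⟩
      obtain ⟨fs, hfs⟩ := ext s
      obtain ⟨fg, hfg⟩ := ext g
      rw [G.entry_eq_agree s fs hfs] at h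
      rw [G.entry_eq_agree g fg hfg] at hg
      obtain ⟨z', h₁, h₂⟩ := GameTree.exists_agree_of_not G.owner i fs fg _ G.wellFormed z hg h
      have := single (G.seqForm_mem g) z'
      have e₁ : G.entry (G.seqForm s) z' = 1 := (G.entry_eq_agree s fs hfs z').trans h₁
      have e₂ : G.entry (G.seqForm g) z' = 0 := (G.entry_eq_agree g fg hfg z').trans h₂
      rw [e₁, e₂] at this
      simpa using this
  · replace h : G.entry (G.seqForm s) z = 1 := h
    have := single hx z
    rw [h] at this ⊢
    rw [abs_of_nonneg (by linarith [G.entry_le_one hx z])]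
    linarith

end Strategies

/-! ### Weighted sums over terminal nodes, and multiaffine functions of profiles. -/

section Weigh

variable {ι : Type} (G : ExtensiveGame (Option ι))

/-- The sum of `φ` over the terminal nodes, weighted by chance and the mediator. -/
noncomputable def weigh (μ : G.Seq none → ℝ) (φ : G.Terminal → ℝ) : ℝ :=
  ∑ z, G.chanceProb z * G.entry μ z * φ z

variable {G} {μ : G.Seq none → ℝ}

theorem weigh_sub (φ ψ : G.Terminal → ℝ) :
    G.weigh μ (fun z => φ z - ψ z) = G.weigh μ φ - G.weigh μ ψ := by
  simp only [weigh, mul_sub, Finset.sum_sub_distrib]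

theorem weigh_add (φ ψ : G.Terminal → ℝ) :
    G.weigh μ (fun z => φ z + ψ z) = G.weigh μ φ + G.weigh μ ψ := by
  simp only [weigh, mul_add, Finset.sum_add_distrib]

theorem weigh_const_mul (c : ℝ) (φ : G.Terminal → ℝ) :
    G.weigh μ (fun z => c * φ z) = c * G.weigh μ φ := by
  simp only [weigh, Finset.mul_sum]
  exact Finset.sum_congr rfl fun z _ => by ring

theorem weigh_sum {β : Type*} (s : Finset β) (φ : β → G.Terminal → ℝ) :
    G.weigh μ (fun z => ∑ k ∈ s, φ k z) = ∑ k ∈ s, G.weigh μ (φ k) := by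
  simp only [weigh, Finset.mul_sum]
  exact Finset.sum_comm

theorem weight_mem (hμ : μ ∈ G.strategies none) (z : G.Terminal) :
    0 ≤ G.chanceProb z * G.entry μ z ∧ G.chanceProb z * G.entry μ z ≤ 1 :=
  ⟨mul_nonneg (G.chanceProb_mem z).1 (G.entry_nonneg hμ z),
    mul_le_one₀ (G.chanceProb_mem z).2 (G.entry_nonneg hμ z) (G.entry_le_one hμ z)⟩

theorem weigh_mono (hμ : μ ∈ G.strategies none) {φ ψ : G.Terminal → ℝ} (h : ∀ z, φ z ≤ ψ z) :
    G.weigh μ φ ≤ G.weigh μ ψ :=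
  Finset.sum_le_sum fun z _ => mul_le_mul_of_nonneg_left (h z) (weight_mem hμ z).1

theorem weigh_nonneg (hμ : μ ∈ G.strategies none) {φ : G.Terminal → ℝ} (h : ∀ z, 0 ≤ φ z) :
    0 ≤ G.weigh μ φ :=
  Finset.sum_nonneg fun z _ => mul_nonneg (weight_mem hμ z).1 (h z)

end Weigh

section Multiaffine

variable {ι : Type} [DecidableEq ι] (G : ExtensiveGame (Option ι))

/-- Functions of profiles that are affine in the strategy of each player. -/
def Multiaffine (F : G.Profile → ℝ) : Prop :=
  ∀ (x : G.Profile) (i : ι) (y y' : G.Seq (some i) → ℝ) (a b : ℝ), a + b = 1 →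
    F (Function.update x i (a • y + b • y')) =
      a * F (Function.update x i y) + b * F (Function.update x i y')

variable {G}

theorem Multiaffine.const (c : ℝ) : G.Multiaffine fun _ => c := by
  intro x i y y' a b h
  simp only
  linear_combination -c * h

theorem Multiaffine.add {F F' : G.Profile → ℝ} (h : G.Multiaffine F) (h' : G.Multiaffine F') :
    G.Multiaffine fun x => F x + F' x := by
  intro x i y y' a b hab
  simp only [h x i y y' a b hab, h' x i y y' a b hab]
  ring

theorem Multiaffine.const_mul {F : G.Profile → ℝ} (c : ℝ) (h : G.Multiaffine F) :
    G.Multiaffine fun x => c * F x := by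
  intro x i y y' a b hab
  simp only [h x i y y' a b hab]
  ring

theorem Multiaffine.sub {F F' : G.Profile → ℝ} (h : G.Multiaffine F) (h' : G.Multiaffine F') :
    G.Multiaffine fun x => F x - F' x := by
  intro x i y y' a b hab
  simp only [h x i y y' a b hab, h' x i y y' a b hab]
  ring

theorem Multiaffine.sum {β : Type*} (s : Finset β) {F : β → G.Profile → ℝ}
    (h : ∀ k ∈ s, G.Multiaffine (F k)) : G.Multiaffine fun x => ∑ k ∈ s, F k x := by
  intro x i y y' a b hab
  simp only [Finset.mul_sum, ← Finset.sum_add_distrib]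
  exact Finset.sum_congr rfl fun k hk => h k hk x i y y' a b hab

theorem Multiaffine.prod_entry (s : Finset ι) (z : G.Terminal) :
    G.Multiaffine fun x => ∏ k ∈ s, G.entry (x k) z := by
  intro x i y y' a b hab
  have hk : ∀ w, ∀ k ∈ s.erase i, G.entry (Function.update x i w k) z = G.entry (x k) z :=
    fun w k hk => by rw [Function.update_of_ne (Finset.ne_of_mem_erase hk)]
  by_cases hi : i ∈ s
  · simp only [← Finset.mul_prod_erase s _ hi, Function.update_self,
      Finset.prod_congr rfl (hk _)]
    rw [entry_combination]
    ring
  · rw [Finset.erase_eq_of_notMem hi] at hk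
    simp only [Finset.prod_congr rfl (hk _)]
    linear_combination -(∏ k ∈ s, G.entry (x k) z) * hab

theorem Multiaffine.entry (i : ι) (z : G.Terminal) : G.Multiaffine fun x => G.entry (x i) z := by
  simpa using Multiaffine.prod_entry {i} z

variable [Fintype ι]

theorem Multiaffine.hat (z : G.Terminal) : G.Multiaffine fun x => G.hat x z :=
  Multiaffine.prod_entry _ z

/-- Mixed strategies are replaced by pure ones one player at a time; in the induction, `S` is the
set of players that may still be mixed. -/
theorem Multiaffine.nonneg {F : G.Profile → ℝ} (hF : G.Multiaffine F)
    (h : ∀ s : ∀ i, G.PureStrategy (some i), 0 ≤ F fun i => G.seqForm (s i))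
    {x : G.Profile} (hx : x ∈ G.profiles) : 0 ≤ F x := by
  have key : ∀ (S : Finset ι) (x : G.Profile), (∀ i ∈ S, x i ∈ G.strategies (some i)) →
      (∀ i ∉ S, x i ∈ Set.range (G.seqForm (i := some i))) → 0 ≤ F x := by
    intro S
    induction S using Finset.induction_on with
    | empty =>
      intro x _ hx
      choose s hs using fun i => hx i (Finset.notMem_empty i)
      rw [← funext hs]
      exact h s
    | insert i S hi ih =>
      intro x hx hx'
      rw [← Function.update_eq_self i x]
      refine G.nonneg_of_seqForm (fun y => F (Function.update x i y))
        (fun y y' a b hab => hF x i y y' a b hab) (fun s => ?_)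
        (hx i (Finset.mem_insert_self i S))
      refine ih _ (fun j hj => ?_) fun j hj => ?_
      · have hji : j ≠ i := fun h => hi (h ▸ hj)
        rw [Function.update_of_ne hji]
        exact hx j (Finset.mem_insert_of_mem hj)
      · by_cases hji : j = i
        · subst hji
          rw [Function.update_self]
          exact ⟨s, rfl⟩
        · rw [Function.update_of_ne hji]
          exact hx' j (by simp [hji, hj])
  exact key Finset.univ x (fun i _ => hx i) (by simp)

end Multiaffine

end ExtensiveGame

/-! ### Reduction to pure profiles, and probabilities of deviation. -/

namespace ExtensiveGame

section Pure

variable {κ : Type} (G : ExtensiveGame κ)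

/-- The joint choice of actions in a pure profile. -/
def joint (s : ∀ j, G.PureStrategy j) (I : G.InfoSet) : G.Action I := s (G.owner I) ⟨I, rfl⟩

theorem entry_joint (s : ∀ j, G.PureStrategy j) (j : κ) (z : G.Terminal) :
    G.entry (G.seqForm (s j)) z = G.tree.agree G.owner j (G.joint s) z :=
  G.entry_eq_agree (s j) (G.joint s) (fun I h => by subst h; rfl) z

end Pure

section Players

variable {ι : Type} [Fintype ι] [DecidableEq ι] {G : ExtensiveGame (Option ι)}

/-- The pure profile of all players that consists of `t` for the mediator and `s` for the other
players. -/
def withMediator (t : G.PureStrategy none) (s : ∀ i, G.PureStrategy (some i)) :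
    ∀ j, G.PureStrategy j
  | none => t
  | some i => s i

/-- In a pure profile the product of all entries, the mediator's included, indicates that every
decision on the path follows one joint rule. This translates weighted sums into expectations on the
tree. -/
theorem weigh_pure (t : G.PureStrategy none) (s : ∀ i, G.PureStrategy (some i))
    (φ : G.Terminal → ℝ) :
    G.weigh (G.seqForm t) (fun z => G.hat (fun i => G.seqForm (s i)) z * φ z) =
      G.tree.expect (G.joint (withMediator t s)) φ := by
  refine Finset.sum_congr rfl fun z _ => ?_
  have h := GameTree.prod_agree G.owner (G.joint (withMediator t s)) G.tree z
  rw [Fintype.prod_option, ← G.entry_joint (withMediator t s) none z,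
    Finset.prod_congr rfl fun i _ => (G.entry_joint (withMediator t s) (some i) z).symm] at h
  rw [← h, ← mul_assoc, mul_assoc (G.chanceProb z)]
  rfl

/-- To prove a multiaffine inequality it suffices to consider pure strategies. -/
theorem weigh_nonneg_of_pure (c : ℝ) (Φ : G.Terminal → G.Profile → ℝ)
    (hΦ : ∀ z, G.Multiaffine (Φ z))
    (h : ∀ (t : G.PureStrategy none) (s : ∀ i, G.PureStrategy (some i)),
      0 ≤ c + G.weigh (G.seqForm t) fun z => Φ z fun i => G.seqForm (s i))
    {μ : G.Seq none → ℝ} (hμ : μ ∈ G.strategies none) {x : G.Profile} (hx : x ∈ G.profiles) :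
    0 ≤ c + G.weigh μ fun z => Φ z x := by
  have aff : G.Multiaffine fun x => c + G.weigh μ fun z => Φ z x :=
    (Multiaffine.const c).add (Multiaffine.sum _ fun z _ => (hΦ z).const_mul _)
  refine aff.nonneg (fun s => ?_) hx
  refine G.nonneg_of_seqForm (fun μ => c + G.weigh μ fun z => Φ z fun i => G.seqForm (s i))
    (fun y y' a b hab => ?_) (fun t => h t s) hμ
  have : G.weigh (a • y + b • y') (fun z => Φ z fun i => G.seqForm (s i)) =
      a * G.weigh y (fun z => Φ z fun i => G.seqForm (s i)) +
        b * G.weigh y' (fun z => Φ z fun i => G.seqForm (s i)) := by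
    simp only [weigh, Finset.mul_sum, ← Finset.sum_add_distrib, entry_combination]
    exact Finset.sum_congr rfl fun z _ => by ring
  rw [this]
  linear_combination -c * hab

/-- For pure profiles this is `GameTree.expect_one`; the identity extends to mixed ones as two
opposite multiaffine inequalities. -/
theorem weigh_hat {μ : G.Seq none → ℝ} (hμ : μ ∈ G.strategies none) {x : G.Profile}
    (hx : x ∈ G.profiles) : G.weigh μ (G.hat x) = 1 := by
  have pure_case : ∀ (t : G.PureStrategy none) (s : ∀ i, G.PureStrategy (some i)),
      G.weigh (G.seqForm t) (fun z => G.hat (fun i => G.seqForm (s i)) z) = 1 := fun t s => by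
    have := weigh_pure t s fun _ => 1
    simp only [mul_one] at this
    exact this.trans (GameTree.expect_one _ _ G.wellFormed)
  have h₁ := weigh_nonneg_of_pure (-1) (fun z x => G.hat x z) Multiaffine.hat
    (fun t s => by rw [pure_case]; norm_num) hμ hx
  have h₂ := weigh_nonneg_of_pure 1 (fun z x => (-1) * G.hat x z)
    (fun z => (Multiaffine.hat z).const_mul _)
    (fun t s => by rw [weigh_const_mul, pure_case]; norm_num) hμ hx
  rw [weigh_const_mul] at h₂
  change 0 ≤ -1 + G.weigh μ (G.hat x) at h₁
  change 0 ≤ 1 + -1 * G.weigh μ (G.hat x) at h₂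
  linarith

theorem hat_nonneg {x : G.Profile} (hx : x ∈ G.profiles) (z : G.Terminal) : 0 ≤ G.hat x z :=
  Finset.prod_nonneg fun i _ => G.entry_nonneg (hx i) z

theorem hat_le_one {x : G.Profile} (hx : x ∈ G.profiles) (z : G.Terminal) : G.hat x z ≤ 1 :=
  Finset.prod_le_one (fun i _ => G.entry_nonneg (hx i) z) fun i _ => G.entry_le_one (hx i) z

/-- `x̂_{-i}[z]`, the product over the players other than `i`. -/
noncomputable def hatOthers (G : ExtensiveGame (Option ι)) (x : G.Profile) (i : ι)
    (z : G.Terminal) : ℝ :=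
  ∏ k ∈ Finset.univ.erase i, G.entry (x k) z

theorem hatOthers_nonneg {x : G.Profile} (hx : x ∈ G.profiles) (i : ι) (z : G.Terminal) :
    0 ≤ G.hatOthers x i z :=
  Finset.prod_nonneg fun i _ => G.entry_nonneg (hx i) z

theorem hatOthers_le_one {x : G.Profile} (hx : x ∈ G.profiles) (i : ι) (z : G.Terminal) :
    G.hatOthers x i z ≤ 1 :=
  Finset.prod_le_one (fun i _ => G.entry_nonneg (hx i) z) fun i _ => G.entry_le_one (hx i) z

theorem hat_eq_mul_hatOthers (x : G.Profile) (i : ι) (z : G.Terminal) :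
    G.hat x z = G.entry (x i) z * G.hatOthers x i z :=
  (Finset.mul_prod_erase _ _ (Finset.mem_univ i)).symm

theorem hat_update (x : G.Profile) (i : ι) (y : G.Seq (some i) → ℝ) (z : G.Terminal) :
    G.hat (Function.update x i y) z = G.entry y z * G.hatOthers x i z := by
  rw [hat_eq_mul_hatOthers _ i, Function.update_self]
  congr 1
  exact Finset.prod_congr rfl fun k hk => by
    rw [Function.update_of_ne (Finset.ne_of_mem_erase hk)]

theorem update_mem_profiles {x : G.Profile} (hx : x ∈ G.profiles) {i : ι}
    {y : G.Seq (some i) → ℝ} (hy : y ∈ G.strategies (some i)) :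
    Function.update x i y ∈ G.profiles := by
  intro j
  by_cases h : j = i
  · subst h; rwa [Function.update_self]
  · rw [Function.update_of_ne h]; exact hx j

theorem seqForm_mem_profiles (s : ∀ i, G.PureStrategy (some i)) :
    (fun i => G.seqForm (s i) : G.Profile) ∈ G.profiles :=
  fun i => G.seqForm_mem (s i)

/-- The probability that `i` deviates from `d` by its strategy in `x` while everyone else
follows `d` after `i` is replaced by `d i`. -/
noncomputable def soleDeviation (μ : G.Seq none → ℝ) (d x : G.Profile) (i : ι) : ℝ :=
  G.weigh μ fun z => G.hat d z * (G.hatOthers x i z - G.hat x z)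

/-- The probability that `i` deviates from `d` by its strategy in `x` while someone else deviates
even if `i` is replaced by `d i`. -/
noncomputable def jointDeviation (μ : G.Seq none → ℝ) (d x : G.Profile) (i : ι) : ℝ :=
  G.weigh μ (fun z => G.hat x z * (1 - G.entry (d i) z)) - G.soleDeviation μ d x i

theorem joint_deviation_le {μ : G.Seq none → ℝ} (hμ : μ ∈ G.strategies none)
    (s : ∀ i, G.PureStrategy (some i)) {x : G.Profile} (hx : x ∈ G.profiles) (i : ι) :
    let d : G.Profile := fun i => G.seqForm (s i)
    G.weigh μ (fun z => G.hat d z * ((1 - G.entry (x i) z) * (1 - G.hatOthers x i z))) +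
      G.weigh μ (fun z => G.hat x z * ((1 - G.entry (d i) z) * (1 - G.hatOthers d i z))) ≤
    ∑ k, G.jointDeviation μ d x k := by
  intro d
  -- The product (1 - x_i)(1 - x̂_{-i}) is multiplied out, with x_i · x̂_{-i} written as x̂, so that
  -- every term is visibly affine in each player's strategy.
  have aff : ∀ z, G.Multiaffine fun x =>
      ∑ k, ((1 - G.entry (d k) z) * G.hat x z -
        G.hat d z * (G.hatOthers x k z - G.hat x z)) -
      (G.hat d z * (1 - G.entry (x i) z - G.hatOthers x i z + G.hat x z) +
        (1 - G.entry (d i) z) * (1 - G.hatOthers d i z) * G.hat x z) := fun z =>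
    (Multiaffine.sum _ fun k _ => ((Multiaffine.hat z).const_mul _).sub
      (((Multiaffine.prod_entry _ z).sub (Multiaffine.hat z)).const_mul _)).sub
      ((((((Multiaffine.const 1).sub (Multiaffine.entry i z)).sub
        (Multiaffine.prod_entry _ z)).add (Multiaffine.hat z)).const_mul _).add
        ((Multiaffine.hat z).const_mul _))
  have eq : ∀ (μ : G.Seq none → ℝ) (x : G.Profile), G.weigh μ (fun z =>
      ∑ k, ((1 - G.entry (d k) z) * G.hat x z -
        G.hat d z * (G.hatOthers x k z - G.hat x z)) -
      (G.hat d z * (1 - G.entry (x i) z - G.hatOthers x i z + G.hat x z) +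
        (1 - G.entry (d i) z) * (1 - G.hatOthers d i z) * G.hat x z)) =
      ∑ k, G.jointDeviation μ d x k -
      (G.weigh μ (fun z => G.hat d z * ((1 - G.entry (x i) z) * (1 - G.hatOthers x i z))) +
        G.weigh μ (fun z => G.hat x z * ((1 - G.entry (d i) z) * (1 - G.hatOthers d i z)))) := by
    intro μ x
    simp only [jointDeviation, soleDeviation, ← weigh_sub, ← weigh_add, ← weigh_sum]
    congr 1
    funext z
    rw [hat_eq_mul_hatOthers x i]
    congr 1
    · exact Finset.sum_congr rfl fun k _ => by ring
    · ring
  have key := weigh_nonneg_of_pure 0 _ aff (fun t r => ?_) hμ hx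
  · rw [zero_add, eq] at key
    exact sub_nonneg.1 key
  rw [zero_add, eq, sub_nonneg]
  -- The set `S` consists of all players but the mediator, whose pure strategy `t` is the same in
  -- both profiles.
  have tree := GameTree.joint_deviation_le G.owner (Finset.univ.map Function.Embedding.some)
    (G.joint (withMediator t s)) (G.joint (withMediator t r))
    (fun I hI => by
      have h : G.owner I = none := by
        cases h : G.owner I with
        | none => rfl
        | some j => simp [h] at hI
      have aux : ∀ (j : Option ι) (hj : G.owner I = j), j = none →
          withMediator t s j ⟨I, hj⟩ = withMediator t r j ⟨I, hj⟩ := by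
        rintro j hj rfl; rfl
      exact aux _ rfl h)
    (i := some i) (by simp) G.tree G.wellFormed
  have others : ∀ (q : ∀ i, G.PureStrategy (some i)) (k : ι) (z : G.Terminal),
      ∏ l ∈ (Finset.univ.map Function.Embedding.some).erase (some k),
        G.tree.agree G.owner l (G.joint (withMediator t q)) z =
      G.hatOthers (fun i => G.seqForm (q i)) k z := fun q k z => by
    rw [show some k = Function.Embedding.some k from rfl, ← Finset.map_erase, Finset.prod_map]
    exact Finset.prod_congr rfl fun l _ => (G.entry_joint (withMediator t q) (some l) z).symm
  have all : ∀ (q : ∀ i, G.PureStrategy (some i)) (z : G.Terminal),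
      ∏ l ∈ Finset.univ.map Function.Embedding.some,
        G.tree.agree G.owner l (G.joint (withMediator t q)) z =
      G.hat (fun i => G.seqForm (q i)) z := fun q z => by
    rw [Finset.prod_map]
    exact Finset.prod_congr rfl fun l _ => (G.entry_joint (withMediator t q) (some l) z).symm
  have one : ∀ (q : ∀ i, G.PureStrategy (some i)) (k : ι) (z : G.Terminal),
      G.tree.agree G.owner (some k) (G.joint (withMediator t q)) z = G.entry (G.seqForm (q k)) z :=
    fun q k z => (G.entry_joint (withMediator t q) (some k) z).symm
  rw [Finset.sum_map] at tree
  simp only [Function.Embedding.some_apply] at tree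
  simp only [jointDeviation, soleDeviation, d, weigh_pure]
  convert tree using 3
  · congr 1; funext z; rw [one, others]
  · congr 1; funext z; rw [one, others]
  · congr 1; funext z; rw [one]
  · congr 1; funext z; rw [others, all]

end Players

end ExtensiveGame

/-! ### Full feedback: payments, deviations and the steering bound. -/

namespace ExtensiveGame

section Players

variable {ι : Type} [Fintype ι] [DecidableEq ι] {G : ExtensiveGame (Option ι)}
  {μ : G.Seq none → ℝ}

theorem util_eq_weigh (i : ι) (x : G.Profile) :
    G.util μ i x = G.weigh μ fun z => G.hat x z * G.payoff (some i) z := by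
  simp only [util, reach, weigh, mul_assoc]

theorem util_multiaffine (i : ι) : G.Multiaffine (G.util μ i) := by
  rw [funext (util_eq_weigh (μ := μ) i)]
  refine Multiaffine.sum _ fun z _ => Multiaffine.const_mul _ ?_
  simpa only [mul_comm] using (Multiaffine.hat z).const_mul (G.payoff (some i) z)

theorem util_nonneg (hμ : μ ∈ G.strategies none) {x : G.Profile} (hx : x ∈ G.profiles) (i : ι) :
    0 ≤ G.util μ i x := by
  rw [util_eq_weigh]
  exact weigh_nonneg hμ fun z => mul_nonneg (hat_nonneg hx z) (G.payoff_mem _ z).1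

theorem util_le_one (hμ : μ ∈ G.strategies none) {x : G.Profile} (hx : x ∈ G.profiles) (i : ι) :
    G.util μ i x ≤ 1 := by
  rw [util_eq_weigh, ← weigh_hat hμ hx]
  exact weigh_mono hμ fun z => mul_le_of_le_one_right (hat_nonneg hx z) (G.payoff_mem _ z).2

theorem continuous_util (i : ι) : Continuous (G.util μ i) := by
  refine continuous_finsetSum _ fun z _ => Continuous.mul ?_ continuous_const
  refine continuous_const.mul (continuous_finsetProd _ fun k _ => ?_)
  exact (continuous_apply _).comp (continuous_apply k)

theorem util_sub_le (hμ : μ ∈ G.strategies none) (i : ι) (x y : G.Profile) (c : ℝ)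
    (h : ∀ z, |G.hat x z - G.hat y z| ≤ c) :
    G.util μ i x - G.util μ i y ≤ Fintype.card G.Terminal * c := by
  rw [util_eq_weigh, util_eq_weigh, ← weigh_sub, weigh, Fintype.card, ← nsmul_eq_mul]
  refine Finset.sum_le_card_nsmul _ _ _ fun z _ => ?_
  have hw := weight_mem hμ z
  have hp := G.payoff_mem (some i) z
  have hc : 0 ≤ c := (abs_nonneg _).trans (h z)
  have h₁ : (G.hat x z - G.hat y z) * G.payoff (some i) z ≤ c := by
    refine (mul_le_mul_of_nonneg_right ((le_abs_self _).trans (h z)) hp.1).trans ?_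
    exact mul_le_of_le_one_right hc hp.2
  calc _ = G.chanceProb z * G.entry μ z *
        ((G.hat x z - G.hat y z) * G.payoff (some i) z) := by ring
    _ ≤ G.chanceProb z * G.entry μ z * c := mul_le_mul_of_nonneg_left h₁ hw.1
    _ ≤ c := mul_le_of_le_one_left hc hw.2

/-- Factors in `[0, 1]` are exchanged one at a time. -/
theorem abs_hat_sub_le {x y : G.Profile} (hx : x ∈ G.profiles) (hy : y ∈ G.profiles)
    (z : G.Terminal) :
    |G.hat x z - G.hat y z| ≤ ∑ i, |G.entry (x i) z - G.entry (y i) z| := by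
  have key : ∀ S : Finset ι, |∏ i ∈ S, G.entry (x i) z - ∏ i ∈ S, G.entry (y i) z| ≤
      ∑ i ∈ S, |G.entry (x i) z - G.entry (y i) z| := by
    intro S
    induction S using Finset.induction_on with
    | empty => simp
    | insert k S hk ih =>
      rw [Finset.prod_insert hk, Finset.prod_insert hk, Finset.sum_insert hk]
      have h₁ : |∏ i ∈ S, G.entry (x i) z| ≤ 1 := by
        rw [abs_of_nonneg (Finset.prod_nonneg fun i _ => G.entry_nonneg (hx i) z)]
        exact Finset.prod_le_one (fun i _ => G.entry_nonneg (hx i) z)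
          fun i _ => G.entry_le_one (hx i) z
      have h₂ : |G.entry (y k) z| ≤ 1 := by
        rw [abs_of_nonneg (G.entry_nonneg (hy k) z)]
        exact G.entry_le_one (hy k) z
      calc _ = |(G.entry (x k) z - G.entry (y k) z) * ∏ i ∈ S, G.entry (x i) z +
            G.entry (y k) z * (∏ i ∈ S, G.entry (x i) z - ∏ i ∈ S, G.entry (y i) z)| := by
            congr 1; ring
        _ ≤ _ := by
            refine (abs_add_le _ _).trans (add_le_add ?_ ?_)
            · rw [abs_mul]
              exact mul_le_of_le_one_right (abs_nonneg _) h₁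
            · rw [abs_mul]
              exact (mul_le_of_le_one_left (abs_nonneg _) h₂).trans ih
  exact key Finset.univ

/-- The total shortfall of the players. -/
noncomputable def totalShortfall (d x : G.Profile) : ℝ := ∑ i, G.shortfall (d i) (x i)

/-- The hypothesis on `y` and `w` covers both uses: the comparison of `d` with `x`, and that of
(y_i, d_{-i}) with (y_i, x_{-i}), where player `i` plays the same on both sides. -/
theorem abs_hat_sub_le_totalShortfall (s : ∀ i, G.PureStrategy (some i)) {x y w : G.Profile}
    (hx : x ∈ G.profiles) (hy : y ∈ G.profiles) (hw : w ∈ G.profiles)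
    (h : ∀ i, y i = w i ∨ y i = G.seqForm (s i) ∧ w i = x i) (z : G.Terminal) :
    |G.hat y z - G.hat w z| ≤ totalShortfall (fun i => G.seqForm (s i)) x := by
  refine (abs_hat_sub_le hy hw z).trans (Finset.sum_le_sum fun i _ => ?_)
  rcases h i with h | ⟨h, h'⟩
  · rw [h, sub_self, abs_zero]
    exact G.shortfall_nonneg (s i) (hx i)
  · rw [h, h']
    exact G.abs_entry_sub_le_shortfall (s i) (hx i) z

section FullFeedback

variable (s : ∀ i, G.PureStrategy (some i))

theorem util_update_sub_le (hμ : μ ∈ G.strategies none) {x : G.Profile} (hx : x ∈ G.profiles)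
    (i : ι) {y : G.Seq (some i) → ℝ} (hy : y ∈ G.strategies (some i)) :
    G.util μ i (Function.update (fun i => G.seqForm (s i)) i y) -
        G.util μ i (Function.update x i y) ≤
      Fintype.card G.Terminal * totalShortfall (fun i => G.seqForm (s i)) x ∧
    G.util μ i (Function.update x i y) -
        G.util μ i (Function.update (fun i => G.seqForm (s i)) i y) ≤
      Fintype.card G.Terminal * totalShortfall (fun i => G.seqForm (s i)) x := by
  have h₁ := update_mem_profiles hx hy
  have h₂ := update_mem_profiles (seqForm_mem_profiles s) hy
  have h := abs_hat_sub_le_totalShortfall s hx h₂ h₁ fun k => by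
    by_cases hk : k = i
    · subst hk; left; simp
    · right; simp [hk]
  exact ⟨util_sub_le hμ i _ _ _ h, util_sub_le hμ i _ _ _ fun z => by rw [abs_sub_comm]; exact h z⟩

theorem bddBelow_util_sub (hμ : μ ∈ G.strategies none) {d x : G.Profile} (hd : d ∈ G.profiles)
    (hx : x ∈ G.profiles) (i : ι) :
    BddBelow (Set.range fun y : G.strategies (some i) =>
      G.util μ i (Function.update d i y.1) - G.util μ i (Function.update x i y.1)) := by
  refine ⟨-1, ?_⟩
  rintro _ ⟨y, rfl⟩
  have h₁ := util_nonneg hμ (update_mem_profiles hd y.2) i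
  have h₂ := util_le_one hμ (update_mem_profiles hx y.2) i
  simp only
  linarith

theorem dot_mem {i : ι} (r : G.PureStrategy (some i)) {y : G.Seq (some i) → ℝ}
    (hy : y ∈ G.strategies (some i)) :
    0 ≤ ∑ σ, G.seqForm r σ * y σ ∧ ∑ σ, G.seqForm r σ * y σ ≤ Fintype.card G.Terminal := by
  have hr := fun σ => G.mem_Icc_of_mem_strategies (G.seqForm_mem r) σ
  have hy' := fun σ => G.mem_Icc_of_mem_strategies hy σ
  refine ⟨Finset.sum_nonneg fun σ _ => mul_nonneg (hr σ).1 (hy' σ).1, ?_⟩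
  have : ∑ σ, G.seqForm r σ * y σ ≤ ∑ _σ : G.Seq (some i), (1 : ℝ) :=
    Finset.sum_le_sum fun σ _ => mul_le_one₀ (hr σ).2 (hy' σ).1 (hy' σ).2
  refine this.trans ?_
  simpa using G.card_seq_le (some i)

variable {s}

theorem fullFeedbackPayment_nonneg (hμ : μ ∈ G.strategies none) {α : ℝ} (hα : 0 ≤ α) (i : ι)
    {x : G.Profile} (hx : x ∈ G.profiles) :
    0 ≤ G.fullFeedbackPayment μ (fun i => G.seqForm (s i)) α i x := by
  have h₁ := mul_nonneg hα (dot_mem (s i) (hx i)).1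
  have h₂ := ciInf_le (bddBelow_util_sub hμ (seqForm_mem_profiles s) hx i) ⟨x i, hx i⟩
  simp only [Function.update_eq_self] at h₂
  unfold fullFeedbackPayment
  linarith

theorem fullFeedbackPayment_le {α : ℝ} (i : ι) {x : G.Profile}
    (a b c : ℝ) (ha : α * ∑ σ, G.seqForm (s i) σ * x i σ ≤ a)
    (hb : G.util μ i (Function.update (fun i => G.seqForm (s i)) i (x i)) - G.util μ i x ≤ b)
    (hc : ∀ y ∈ G.strategies (some i), G.util μ i (Function.update x i y) -
        G.util μ i (Function.update (fun i => G.seqForm (s i)) i y) ≤ c) :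
    G.fullFeedbackPayment μ (fun i => G.seqForm (s i)) α i x ≤ a + b + c := by
  have : Nonempty (G.strategies (some i)) := (G.strategies_nonempty _).to_subtype
  have h := le_ciInf (f := fun y : G.strategies (some i) =>
    G.util μ i (Function.update (fun i => G.seqForm (s i)) i y.1) -
      G.util μ i (Function.update x i y.1)) (c := -c) fun y => by
        have := hc y.1 y.2; linarith
  unfold fullFeedbackPayment
  linarith

/-- The first term is the directness bonus. The sandboxing term and the subtracted infimum both
compare utilities of profiles in which only the players other than `i` change between `d` and `x`.
-/
theorem fullFeedbackPayment_le_shortfall (hμ : μ ∈ G.strategies none) {α : ℝ} (hα : 0 ≤ α) (i : ι)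
    {x : G.Profile} (hx : x ∈ G.profiles) :
    G.fullFeedbackPayment μ (fun i => G.seqForm (s i)) α i x ≤
      Fintype.card G.Terminal * α +
      Fintype.card G.Terminal * totalShortfall (fun i => G.seqForm (s i)) x +
      Fintype.card G.Terminal * totalShortfall (fun i => G.seqForm (s i)) x := by
  refine fullFeedbackPayment_le i _ _ _ ?_ ?_ fun y hy => (util_update_sub_le s hμ hx i hy).2
  · rw [mul_comm]
    exact mul_le_mul_of_nonneg_right (dot_mem (s i) (hx i)).2 hα
  · simpa using (util_update_sub_le s hμ hx i (hx i)).1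

theorem isPaymentFunction_fullFeedbackPayment (hμ : μ ∈ G.strategies none) {α : ℝ} (hα : 0 ≤ α)
    (hα' : α ≤ 1 / Fintype.card G.Terminal) (i : ι) :
    G.IsPaymentFunction 3 i (G.fullFeedbackPayment μ (fun i => G.seqForm (s i)) α i) where
  nonneg x hx := fullFeedbackPayment_nonneg hμ hα i hx
  le_bound x hx := by
    have := G.nonempty_terminal
    have hZ : (0 : ℝ) < Fintype.card G.Terminal := by exact_mod_cast Fintype.card_pos
    -- One unit each for the bonus, which is at most `α` times the number of sequences, for the
    -- sandboxing term, and for the negated infimum.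
    rw [show (3 : ℝ) = 1 + 1 + 1 by norm_num]
    have hd := seqForm_mem_profiles s
    refine fullFeedbackPayment_le i _ _ _ ?_ ?_ fun y hy => ?_
    · rw [le_div_iff₀ hZ] at hα'
      exact (mul_le_mul_of_nonneg_left (dot_mem (s i) (hx i)).2 hα).trans hα'
    · have h₁ := util_le_one hμ (update_mem_profiles hd (hx i)) i
      have h₂ := util_nonneg hμ hx i
      linarith
    · have h₁ := util_nonneg hμ (update_mem_profiles hd hy) i
      have h₂ := util_le_one hμ (update_mem_profiles hx hy) i
      linarith
  linear x hx y hy y' hy' a b ha hb hab := by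
    unfold fullFeedbackPayment
    simp only [Function.update_self, Function.update_idem, util_multiaffine i _ i y y' a b hab]
    have : ∑ σ, G.seqForm (s i) σ * (a • y + b • y') σ =
        a * ∑ σ, G.seqForm (s i) σ * y σ + b * ∑ σ, G.seqForm (s i) σ * y' σ := by
      simp only [Finset.mul_sum, ← Finset.sum_add_distrib]
      exact Finset.sum_congr rfl fun σ _ => by simp; ring
    rw [this]
    -- The infimum does not see the strategy of `i`; as a constant it is compatible with
    -- combinations of total weight 1.
    generalize (⨅ y : G.strategies (some i),
      (G.util μ i (Function.update (fun i => G.seqForm (s i)) i y.1) -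
        G.util μ i (Function.update x i y.1))) = m
    linear_combination m * hab
  continuous y hy := by
    refine Continuous.continuousOn ?_
    unfold fullFeedbackPayment
    simp only [Function.update_self, Function.update_idem]
    refine Continuous.sub (continuous_const.add (continuous_const.sub ?_)) ?_
    · exact (continuous_util i).comp (continuous_id.update i continuous_const)
    -- An infimum over a compact set of a jointly continuous function is continuous in the
    -- parameter.
    · have := (G.isCompact_strategies (some i)).continuous_sInf (f := fun (x : G.Profile) y =>
        G.util μ i (Function.update (fun i => G.seqForm (s i)) i y) -
          G.util μ i (Function.update x i y)) <|
        ((continuous_util i).comp (continuous_const.update i continuous_snd)).sub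
          ((continuous_util i).comp (continuous_fst.update i continuous_snd))
      simpa only [sInf_image'] using this

/-- Utility plus payment equals u_i(x_i, d_{-i}) + α d_i·x_i minus a term that depends only on
x_{-i}. Switching to `d i` therefore changes it by the shortfall term plus u_i(d) - u_i(x_i,
d_{-i}), which is nonnegative at a Nash equilibrium. -/
theorem fullFeedbackPayment_deviation
    (hd : G.IsNash μ fun i => G.seqForm (s i)) (α : ℝ) (i : ι)
    {x : G.Profile} (hx : x ∈ G.profiles) :
    let d : G.Profile := fun i => G.seqForm (s i)
    α * G.shortfall (d i) (x i) ≤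
      (G.util μ i (Function.update x i (d i)) +
        G.fullFeedbackPayment μ d α i (Function.update x i (d i))) -
      (G.util μ i x + G.fullFeedbackPayment μ d α i x) := by
  intro d
  have h := hd.2 i (x i) (hx i)
  unfold fullFeedbackPayment shortfall
  simp only [Function.update_self, Function.update_idem, Function.update_eq_self, mul_sub,
    Finset.sum_sub_distrib]
  change G.util μ i (Function.update d i (x i)) ≤ G.util μ i d at h
  linarith

end FullFeedback

theorem sum_deviation_le_of_regret_le (hμ : μ ∈ G.strategies none) {P R : ℝ} (hP : 0 ≤ P)
    {p : ι → G.Profile → ℝ} {T : ℕ} {x : ℕ → G.Profile} (hx : ∀ t, x t ∈ G.profiles) {i : ι}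
    (hp : ∀ x ∈ G.profiles, p i x ≤ P) (h : G.regret μ P p T x i ≤ R)
    {y : G.Seq (some i) → ℝ} (hy : y ∈ G.strategies (some i)) :
    ∑ t ∈ Finset.range T, ((G.util μ i (Function.update (x t) i y) +
      p i (Function.update (x t) i y)) - (G.util μ i (x t) + p i (x t))) ≤ (P + 1) * R := by
  unfold regret at h
  rw [one_div, inv_mul_le_iff₀ (by linarith)] at h
  refine le_trans ?_ h
  rw [Finset.sum_sub_distrib]
  -- The supremum in the regret is a true upper bound only because the values are bounded: utilities
  -- by 1 and payments by `P`.
  refine sub_le_sub_right (le_ciSup (f := fun y : G.strategies (some i) =>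
    ∑ t ∈ Finset.range T, (G.util μ i (Function.update (x t) i y.1) +
      p i (Function.update (x t) i y.1))) ⟨∑ t ∈ Finset.range T, (1 + P), ?_⟩ ⟨y, hy⟩) _
  rintro _ ⟨y, rfl⟩
  refine Finset.sum_le_sum fun t _ => add_le_add ?_ ?_
  · exact util_le_one hμ (update_mem_profiles (hx t) y.2) i
  · exact hp _ (update_mem_profiles (hx t) y.2)

theorem outcomeGap_le_directnessGap (hμ : μ ∈ G.strategies none) (d : G.Profile) (T : ℕ)
    (x : ℕ → G.Profile) : G.outcomeGap μ d T x ≤ G.directnessGap d T x := by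
  refine Finset.sum_le_sum fun z _ => ?_
  have : 1 / (T : ℝ) * ∑ t ∈ Finset.range T, G.reach μ (x t) z - G.reach μ d z =
      G.chanceProb z * G.entry μ z *
        (1 / (T : ℝ) * ∑ t ∈ Finset.range T, G.hat (x t) z - G.hat d z) := by
    simp only [reach, ← Finset.mul_sum]
    ring
  have hw := weight_mem hμ z
  rw [this, abs_mul, abs_of_nonneg hw.1]
  exact mul_le_of_le_one_left (abs_nonneg _) hw.2

/-- An average is as close to `c` as its terms are on average. -/
theorem abs_average_sub_le {T : ℕ} (hT : 0 < T) (f g : ℕ → ℝ) (c : ℝ)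
    (h : ∀ t, |f t - c| ≤ g t) :
    |1 / (T : ℝ) * ∑ t ∈ Finset.range T, f t - c| ≤ 1 / (T : ℝ) * ∑ t ∈ Finset.range T, g t := by
  have hT' : (0 : ℝ) < T := by exact_mod_cast hT
  have : 1 / (T : ℝ) * ∑ t ∈ Finset.range T, f t - c =
      1 / (T : ℝ) * ∑ t ∈ Finset.range T, (f t - c) := by
    rw [Finset.sum_sub_distrib]
    simp
    field_simp
  rw [this, abs_mul, abs_of_nonneg (by positivity)]
  refine mul_le_mul_of_nonneg_left ?_ (by positivity)
  exact (Finset.abs_sum_le_sum_abs _ _).trans (Finset.sum_le_sum fun t _ => h t)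

theorem fullFeedback_steers (hμ : μ ∈ G.strategies none) (s : ∀ i, G.PureStrategy (some i))
    (hd : G.IsNash μ fun i => G.seqForm (s i)) {T : ℕ} (hT : 0 < T) {R : ℝ} (hR : 0 < R)
    {x : ℕ → G.Profile} (hx : ∀ t, x t ∈ G.profiles) {ε : ℝ}
    (hε : ε = 4 * Fintype.card ι * R / T) (hα : √ε ≤ 1 / Fintype.card G.Terminal)
    (hreg : ∀ i, G.regret μ 3 (G.fullFeedbackPayment μ (fun i => G.seqForm (s i)) √ε) T x i ≤ R) :
    let d : G.Profile := fun i => G.seqForm (s i)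
    let Z : ℝ := Fintype.card G.Terminal
    (∀ i, G.avgPayment (G.fullFeedbackPayment μ d √ε) T x i ≤ 3 * Z * √ε) ∧
    G.directnessGap d T x ≤ 3 * Z * √ε ∧ G.outcomeGap μ d T x ≤ 3 * Z * √ε := by
  intro d Z
  have hT' : (0 : ℝ) < T := by exact_mod_cast hT
  have hZ : 0 ≤ Z := Nat.cast_nonneg _
  have avg : 1 / (T : ℝ) * ∑ t ∈ Finset.range T, totalShortfall d (x t) ≤ √ε := by
    have each : ∀ i : ι, √ε * ∑ t ∈ Finset.range T, G.shortfall (d i) (x t i) ≤ 4 * R := by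
      intro i
      have h := sum_deviation_le_of_regret_le hμ (by norm_num) hx
        (isPaymentFunction_fullFeedbackPayment hμ (Real.sqrt_nonneg _) hα i).le_bound (hreg i)
        (G.seqForm_mem (s i))
      rw [Finset.mul_sum]
      refine (Finset.sum_le_sum fun t _ =>
        fullFeedbackPayment_deviation hd √ε i (hx t)).trans (h.trans ?_)
      norm_num
    have total := Finset.sum_le_card_nsmul Finset.univ _ _ fun i _ => each i
    rw [← Finset.mul_sum, Finset.sum_comm, nsmul_eq_mul, Finset.card_univ] at total
    change √ε * ∑ t ∈ Finset.range T, totalShortfall d (x t) ≤ _ at total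
    -- Without players `ε = 0` and division by `√ε` is impossible, but then the total shortfall is
    -- an empty sum.
    rcases isEmpty_or_nonempty ι with hι | hι
    · simp [totalShortfall]
    have hn : (0 : ℝ) < Fintype.card ι := by exact_mod_cast Fintype.card_pos
    have hε0 : 0 < ε := by rw [hε]; positivity
    have hs : 0 < √ε := Real.sqrt_pos.2 hε0
    have hss : √ε * √ε = ε := Real.mul_self_sqrt hε0.le
    refine le_of_mul_le_mul_left ?_ hs
    rw [hss, hε, mul_left_comm, one_div, inv_mul_le_iff₀ hT']
    rw [hε] at total
    refine total.trans (le_of_eq ?_)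
    field_simp
  have hgap : G.directnessGap d T x ≤ Z * √ε := by
    unfold directnessGap
    have : ∀ z ∈ Finset.univ, |1 / (T : ℝ) * ∑ t ∈ Finset.range T, G.hat (x t) z - G.hat d z| ≤
        √ε := fun z _ =>
      (abs_average_sub_le hT _ _ _ fun t => by
        rw [abs_sub_comm]
        exact abs_hat_sub_le_totalShortfall s (hx t) (seqForm_mem_profiles s) (hx t)
          (fun i => Or.inr ⟨rfl, rfl⟩) z).trans avg
    simpa [Z] using Finset.sum_le_card_nsmul _ _ _ this
  have hle : Z * √ε ≤ 3 * Z * √ε := by nlinarith [mul_nonneg hZ (Real.sqrt_nonneg ε)]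
  refine ⟨fun i => ?_, hgap.trans hle, (outcomeGap_le_directnessGap hμ d T x).trans (hgap.trans hle)⟩
  unfold avgPayment
  have h₁ : ∑ t ∈ Finset.range T, G.fullFeedbackPayment μ d √ε i (x t) ≤
      ∑ t ∈ Finset.range T, (Z * √ε + 2 * Z * totalShortfall d (x t)) :=
    Finset.sum_le_sum fun t _ =>
      (fullFeedbackPayment_le_shortfall hμ (Real.sqrt_nonneg _) i (hx t)).trans_eq
        (by simp only [Z, d]; ring)
  rw [Finset.sum_add_distrib, Finset.sum_const, ← Finset.mul_sum, Finset.card_range,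
    nsmul_eq_mul] at h₁
  refine (mul_le_mul_of_nonneg_left h₁ (by positivity)).trans ?_
  have h₂ : 1 / (T : ℝ) * (T * (Z * √ε)) = Z * √ε := by field_simp
  rw [mul_add, h₂]
  have h₃ := mul_le_mul_of_nonneg_left avg (mul_nonneg zero_le_two hZ)
  linarith

end Players

end ExtensiveGame

/-! ### Trajectory payments: sole and joint deviations, and the steering bound. -/

namespace ExtensiveGame

section Players

variable {ι : Type} [Fintype ι] [DecidableEq ι] {G : ExtensiveGame (Option ι)}
  {μ : G.Seq none → ℝ}

theorem prod_entry_seqForm_eq_zero_or_one (s : ∀ i, G.PureStrategy (some i)) (S : Finset ι)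
    (z : G.Terminal) :
    ∏ k ∈ S, G.entry (G.seqForm (s k)) z = 0 ∨ ∏ k ∈ S, G.entry (G.seqForm (s k)) z = 1 := by
  by_cases h : ∃ k ∈ S, G.entry (G.seqForm (s k)) z = 0
  · obtain ⟨k, hk, h⟩ := h
    exact Or.inl (Finset.prod_eq_zero hk h)
  · push Not at h
    exact Or.inr (Finset.prod_eq_one fun k hk =>
      (G.seqForm_eq_zero_or_one (s k) _).resolve_left (h k hk))

theorem trajectoryPay_mem (s : ∀ i, G.PureStrategy (some i)) {α P : ℝ} (hα : 0 ≤ α) (hP : α ≤ P)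
    (i : ι) (z : G.Terminal) :
    0 ≤ G.trajectoryPay (fun i => G.seqForm (s i)) α P i z ∧
      G.trajectoryPay (fun i => G.seqForm (s i)) α P i z ≤ P := by
  unfold trajectoryPay
  have h₁ : G.hat (fun i => G.seqForm (s i)) z = 0 ∨ G.hat (fun i => G.seqForm (s i)) z = 1 :=
    prod_entry_seqForm_eq_zero_or_one s Finset.univ z
  have h₂ : G.entry (G.seqForm (s i)) z = 0 ∨ G.entry (G.seqForm (s i)) z = 1 :=
    G.seqForm_eq_zero_or_one (s i) _
  rcases h₁ with h₁ | h₁ <;> rcases h₂ with h₂ | h₂ <;> rw [h₁, h₂] <;> constructor <;> linarith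

theorem trajectoryPayment_eq_weigh (d : G.Profile) (α P : ℝ) (i : ι) (x : G.Profile) :
    G.trajectoryPayment μ d α P i x =
      G.weigh μ fun z => G.hat x z * G.trajectoryPay d α P i z := by
  simp only [trajectoryPayment, reach, weigh, mul_assoc]

theorem jointDeviation_nonneg (hμ : μ ∈ G.strategies none) {d x : G.Profile}
    (hd : d ∈ G.profiles) (hx : x ∈ G.profiles) (i : ι) : 0 ≤ G.jointDeviation μ d x i := by
  have h₁ : G.weigh μ (fun z => G.entry (d i) z * G.hatOthers x i z) = 1 := by
    simp only [← hat_update]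
    exact weigh_hat hμ (update_mem_profiles hx (hd i))
  have h₂ : G.weigh μ (fun z => G.hat x z) = 1 := weigh_hat hμ hx
  -- The added term d_i · x̂_{-i} - x̂ has total weight 1 - 1 = 0, and it turns the integrand of the
  -- joint deviation into d_i · x̂_{-i} (1 - x_i)(1 - d̂_{-i}), which is nonnegative pointwise.
  have h : 0 ≤ G.weigh μ (fun z => (G.hat x z * (1 - G.entry (d i) z) -
      G.hat d z * (G.hatOthers x i z - G.hat x z)) +
      (G.entry (d i) z * G.hatOthers x i z - G.hat x z)) := by
    refine weigh_nonneg hμ fun z => ?_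
    have hX := hatOthers_nonneg hx i z
    have hD := hatOthers_le_one hd i z
    have : 0 ≤ G.entry (d i) z * G.hatOthers x i z * (1 - G.entry (x i) z) *
        (1 - G.hatOthers d i z) :=
      mul_nonneg (mul_nonneg (mul_nonneg (G.entry_nonneg (hd i) z) hX)
        (sub_nonneg.2 (G.entry_le_one (hx i) z))) (sub_nonneg.2 hD)
    rw [hat_eq_mul_hatOthers x i, hat_eq_mul_hatOthers d i]
    linarith
  rw [weigh_add, weigh_sub, weigh_sub, h₁, h₂] at h
  unfold jointDeviation soleDeviation
  linarith

theorem trajectoryPayment_deviation (hμ : μ ∈ G.strategies none)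
    (s : ∀ i, G.PureStrategy (some i)) (α P : ℝ) (i : ι) {x : G.Profile} (hx : x ∈ G.profiles) :
    let d : G.Profile := fun i => G.seqForm (s i)
    G.trajectoryPayment μ d α P i (Function.update x i (d i)) - G.trajectoryPayment μ d α P i x =
      α * G.soleDeviation μ d x i + P * G.jointDeviation μ d x i := by
  intro d
  have hd : d ∈ G.profiles := seqForm_mem_profiles s
  have h₁ : G.weigh μ (fun z => G.entry (d i) z * G.hatOthers x i z) = 1 := by
    simp only [← hat_update]
    exact weigh_hat hμ (update_mem_profiles hx (hd i))
  have h₂ : G.weigh μ (fun z => G.hat x z) = 1 := weigh_hat hμ hx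
  -- Again a term of total weight zero is added to the joint deviation. The identity then holds
  -- pointwise: if d_i[z] = 0 both sides vanish, and if d_i[z] = 1 the pay is `α` or `P` according
  -- to whether the others are direct.
  have h : G.weigh μ (fun z =>
        G.hat (Function.update x i (d i)) z * G.trajectoryPay d α P i z -
          G.hat x z * G.trajectoryPay d α P i z) =
      G.weigh μ (fun z => α * (G.hat d z * (G.hatOthers x i z - G.hat x z)) +
        P * ((G.hat x z * (1 - G.entry (d i) z) -
          G.hat d z * (G.hatOthers x i z - G.hat x z)) +
          (G.entry (d i) z * G.hatOthers x i z - G.hat x z))) := by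
    congr 1
    funext z
    rw [hat_update, trajectoryPay, hat_eq_mul_hatOthers d i, hat_eq_mul_hatOthers x i]
    have : G.entry (d i) z = 0 ∨ G.entry (d i) z = 1 := G.seqForm_eq_zero_or_one (s i) _
    rcases this with h | h <;> rw [h] <;> ring
  rw [weigh_sub, weigh_add, weigh_const_mul, weigh_const_mul, weigh_add, weigh_sub, weigh_sub,
    h₁, h₂] at h
  rw [trajectoryPayment_eq_weigh, trajectoryPayment_eq_weigh, h, jointDeviation, soleDeviation]
  ring

/-- The gain from switching to `d i` against x_{-i} is compared with the gain against d_{-i}, which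
is nonnegative at equilibrium. The two differ only where `i` and some other player both deviate, and
`joint_deviation_le` bounds the probability of that. -/
theorem util_deviation (hμ : μ ∈ G.strategies none) (s : ∀ i, G.PureStrategy (some i))
    (hN : G.IsNash μ fun i => G.seqForm (s i)) (i : ι) {x : G.Profile} (hx : x ∈ G.profiles) :
    let d : G.Profile := fun i => G.seqForm (s i)
    G.util μ i x - ∑ k, G.jointDeviation μ d x k ≤ G.util μ i (Function.update x i (d i)) := by
  intro d
  have nash := hN.2 i (x i) (hx i)
  change G.util μ i (Function.update d i (x i)) ≤ G.util μ i d at nash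
  have hjoint := joint_deviation_le hμ s hx i
  -- Pointwise this says that (d_i - x_i)(d̂_{-i} - x̂_{-i}) u is at most d̂ (1 - x_i)(1 - x̂_{-i})
  -- + x̂ (1 - d_i)(1 - d̂_{-i}) for u in [0, 1]; it is checked for the four 0/1 values of d_i and
  -- d̂_{-i}.
  have h := weigh_mono (μ := μ) hμ (φ := fun z =>
      (G.hat d z * G.payoff (some i) z -
        G.hat (Function.update d i (x i)) z * G.payoff (some i) z) -
      (G.hat d z * ((1 - G.entry (x i) z) * (1 - G.hatOthers x i z)) +
        G.hat x z * ((1 - G.entry (d i) z) * (1 - G.hatOthers d i z))))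
    (ψ := fun z => G.hat (Function.update x i (d i)) z * G.payoff (some i) z -
      G.hat x z * G.payoff (some i) z) fun z => by
    simp only [hat_update]
    rw [hat_eq_mul_hatOthers d i, hat_eq_mul_hatOthers x i]
    have e₁ : G.entry (d i) z = 0 ∨ G.entry (d i) z = 1 := G.seqForm_eq_zero_or_one (s i) _
    have e₂ : G.hatOthers d i z = 0 ∨ G.hatOthers d i z = 1 :=
      prod_entry_seqForm_eq_zero_or_one s _ z
    have ha := G.entry_nonneg (hx i) z
    have ha' := G.entry_le_one (hx i) z
    have hb := hatOthers_nonneg hx i z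
    have hb' := hatOthers_le_one hx i z
    obtain ⟨hu, hu'⟩ := G.payoff_mem (some i) z
    generalize G.payoff (some i) z = u at *
    generalize G.entry (x i) z = a at *
    generalize G.hatOthers x i z = b at *
    rcases e₁ with e₁ | e₁ <;> rcases e₂ with e₂ | e₂ <;> rw [e₁, e₂]
    · have := mul_nonneg (mul_nonneg ha hb) (sub_nonneg.2 hu')
      linarith
    · have := mul_nonneg (mul_nonneg hu ha) (sub_nonneg.2 hb')
      linarith
    · have := mul_nonneg (mul_nonneg hu (sub_nonneg.2 ha')) hb
      linarith
    · have := mul_nonneg (mul_nonneg (sub_nonneg.2 hu') (sub_nonneg.2 ha')) (sub_nonneg.2 hb')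
      linarith
  rw [weigh_sub, weigh_sub, weigh_sub, weigh_add, ← util_eq_weigh, ← util_eq_weigh,
    ← util_eq_weigh, ← util_eq_weigh] at h
  change _ ≤ ∑ k, G.jointDeviation μ d x k at hjoint
  linarith

/-- The sum over the players of the probabilities of having deviated from `d`. -/
noncomputable def totalDeviation (μ : G.Seq none → ℝ) (d x : G.Profile) : ℝ :=
  ∑ i, G.weigh μ fun z => G.hat x z * (1 - G.entry (d i) z)

theorem totalDeviation_eq (d x : G.Profile) :
    totalDeviation μ d x = ∑ i, G.soleDeviation μ d x i + ∑ i, G.jointDeviation μ d x i := by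
  simp only [totalDeviation, jointDeviation, ← Finset.sum_add_distrib]
  exact Finset.sum_congr rfl fun i _ => by ring

theorem weigh_indirect_le (hμ : μ ∈ G.strategies none) {d x : G.Profile} (hd : d ∈ G.profiles)
    (hx : x ∈ G.profiles) :
    G.weigh μ (fun z => G.hat x z * (1 - G.hat d z)) ≤ totalDeviation μ d x := by
  rw [totalDeviation, ← weigh_sum]
  refine weigh_mono hμ fun z => ?_
  rw [← Finset.mul_sum]
  exact mul_le_mul_of_nonneg_left (GameTree.one_sub_prod_le _ (fun k => G.entry (d k) z)
    (fun k => G.entry_nonneg (hd k) z) fun k => G.entry_le_one (hd k) z) (hat_nonneg hx z)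

theorem sum_abs_reach_sub_le (hμ : μ ∈ G.strategies none) (s : ∀ i, G.PureStrategy (some i))
    {x : G.Profile} (hx : x ∈ G.profiles) :
    ∑ z, |G.reach μ x z - G.reach μ (fun i => G.seqForm (s i)) z| ≤
      2 * totalDeviation μ (fun i => G.seqForm (s i)) x := by
  have hd := seqForm_mem_profiles s
  have h₁ : G.weigh μ (fun z => G.hat x z) = 1 := weigh_hat hμ hx
  have h₂ : G.weigh μ (fun z => G.hat (fun i => G.seqForm (s i)) z) = 1 := weigh_hat hμ hd
  -- Since d̂ is 0 or 1, |x̂ - d̂| = 2 x̂ (1 - d̂) + (d̂ - x̂), and the last term has total weight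
  -- zero.
  have eq : ∑ z, |G.reach μ x z - G.reach μ (fun i => G.seqForm (s i)) z| =
      G.weigh μ fun z => 2 * (G.hat x z * (1 - G.hat (fun i => G.seqForm (s i)) z)) +
        (G.hat (fun i => G.seqForm (s i)) z - G.hat x z) := by
    refine Finset.sum_congr rfl fun z _ => ?_
    have hw := (weight_mem hμ z).1
    rw [reach, reach, ← mul_sub, abs_mul, abs_of_nonneg hw]
    congr 1
    have h : G.hat (fun i => G.seqForm (s i)) z = 0 ∨ G.hat (fun i => G.seqForm (s i)) z = 1 :=
      prod_entry_seqForm_eq_zero_or_one s _ z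
    have h0 := hat_nonneg hx z
    have h1 := hat_le_one hx z
    beta_reduce
    rcases h with h | h <;> rw [h]
    · rw [sub_zero, abs_of_nonneg h0]; ring
    · rw [abs_sub_comm, abs_of_nonneg (by linarith)]; ring
  rw [eq, weigh_add, weigh_sub, h₁, h₂, weigh_const_mul, sub_self, add_zero]
  exact mul_le_mul_of_nonneg_left (weigh_indirect_le hμ hd hx) zero_le_two

theorem trajectoryPayment_nonneg (hμ : μ ∈ G.strategies none) (s : ∀ i, G.PureStrategy (some i))
    {α P : ℝ} (hα : 0 ≤ α) (hP : α ≤ P) (i : ι) {x : G.Profile} (hx : x ∈ G.profiles) :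
    0 ≤ G.trajectoryPayment μ (fun i => G.seqForm (s i)) α P i x := by
  rw [trajectoryPayment_eq_weigh]
  exact weigh_nonneg hμ fun z => mul_nonneg (hat_nonneg hx z) (trajectoryPay_mem s hα hP i z).1

theorem trajectoryPayment_le_bound (hμ : μ ∈ G.strategies none)
    (s : ∀ i, G.PureStrategy (some i)) {α P : ℝ} (hα : 0 ≤ α) (hP : α ≤ P) (i : ι)
    {x : G.Profile} (hx : x ∈ G.profiles) :
    G.trajectoryPayment μ (fun i => G.seqForm (s i)) α P i x ≤ P := by
  have h : G.weigh μ (fun z => G.hat x z) = 1 := weigh_hat hμ hx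
  calc _ ≤ G.weigh μ (fun z => P * G.hat x z) := by
        rw [trajectoryPayment_eq_weigh]
        refine weigh_mono hμ fun z => ?_
        rw [mul_comm]
        exact mul_le_mul_of_nonneg_right (trajectoryPay_mem s hα hP i z).2 (hat_nonneg hx z)
    _ = P := by rw [weigh_const_mul, h, mul_one]

theorem trajectoryPayment_le (hμ : μ ∈ G.strategies none) {d : G.Profile} (hd : d ∈ G.profiles)
    {α P : ℝ} (hα : 0 ≤ α) (hP : 0 ≤ P) (i : ι) {x : G.Profile} (hx : x ∈ G.profiles) :
    G.trajectoryPayment μ d α P i x ≤ α + P * totalDeviation μ d x := by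
  have h : G.weigh μ (fun z => G.hat x z) = 1 := weigh_hat hμ hx
  calc _ ≤ G.weigh μ (fun z => α * G.hat x z + P * (G.hat x z * (1 - G.hat d z))) := by
        rw [trajectoryPayment_eq_weigh]
        refine weigh_mono hμ fun z => ?_
        have h₁ := hat_le_one hd z
        have h₂ := G.entry_le_one (hd i) z
        have h₃ := hat_nonneg hx z
        have h₄ : 0 ≤ P * (1 - G.hat d z) * (1 - G.entry (d i) z) :=
          mul_nonneg (mul_nonneg hP (sub_nonneg.2 h₁)) (sub_nonneg.2 h₂)
        have h₅ : G.trajectoryPay d α P i z ≤ α + P * (1 - G.hat d z) := by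
          unfold trajectoryPay
          have := mul_nonneg hα (sub_nonneg.2 h₁)
          linarith
        refine (mul_le_mul_of_nonneg_left h₅ h₃).trans_eq ?_
        ring
    _ = α + P * G.weigh μ (fun z => G.hat x z * (1 - G.hat d z)) := by
        rw [weigh_add, weigh_const_mul, weigh_const_mul, h, mul_one]
    _ ≤ _ := by
        have := mul_le_mul_of_nonneg_left (weigh_indirect_le hμ hd hx) hP
        linarith

/-- A player whose moves agree with `d` on every path never deviates. -/
theorem deviation_eq_zero {d x : G.Profile} {i : ι}
    (hd : ∀ z, G.entry (d i) z = 1) (hx : ∀ z, G.entry (x i) z = 1) :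
    G.soleDeviation μ d x i = 0 ∧ G.jointDeviation μ d x i = 0 := by
  have h : G.soleDeviation μ d x i = 0 := by
    simp [soleDeviation, hat_eq_mul_hatOthers x i, hx, weigh]
  refine ⟨h, ?_⟩
  rw [jointDeviation, h]
  simp [hd, weigh]

theorem entry_eq_one {κ : Type} (G : ExtensiveGame κ) {i : κ}
    (h : ∀ (r : G.PureStrategy i) z, G.entry (G.seqForm r) z = 1) {y : G.Seq i → ℝ}
    (hy : y ∈ G.strategies i) (z : G.Terminal) : G.entry y z = 1 := by
  refine le_antisymm (G.entry_le_one hy z) ?_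
  have := G.nonneg_of_seqForm (fun y => G.entry y z - 1)
    (fun y y' a b hab => by rw [entry_combination]; linear_combination hab)
    (fun r => by rw [h, sub_self]) hy
  simpa using this

/-- Only the regrets of the players in `S` are added; the others never deviate. This puts `S.card`
in the bound instead of the number of all players. -/
theorem sum_totalDeviation_le (hμ : μ ∈ G.strategies none) (s : ∀ i, G.PureStrategy (some i))
    (hN : G.IsNash μ fun i => G.seqForm (s i)) (S : Finset ι)
    (hS : ∀ i ∉ S, ∀ (r : G.PureStrategy (some i)) z, G.entry (G.seqForm r) z = 1)
    {α P R : ℝ} (hα : 0 ≤ α) (hP : α + S.card ≤ P) {T : ℕ}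
    {x : ℕ → G.Profile} (hx : ∀ t, x t ∈ G.profiles)
    (hreg : ∀ i, G.regret μ P (G.trajectoryPayment μ (fun i => G.seqForm (s i)) α P) T x i ≤ R) :
    α * ∑ t ∈ Finset.range T, totalDeviation μ (fun i => G.seqForm (s i)) (x t) ≤
      S.card * ((P + 1) * R) := by
  set d : G.Profile := fun i => G.seqForm (s i) with hd
  have hdp : d ∈ G.profiles := seqForm_mem_profiles s
  have hm : (0 : ℝ) ≤ S.card := Nat.cast_nonneg _
  have each := fun i => sum_deviation_le_of_regret_le hμ (by linarith) hx
    (fun y hy => trajectoryPayment_le_bound hμ s hα (by linarith) i hy) (hreg i)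
    (G.seqForm_mem (s i))
  have total := Finset.sum_le_card_nsmul S _ _ fun i _ => each i
  rw [nsmul_eq_mul, Finset.sum_comm] at total
  rw [Finset.mul_sum]
  refine (Finset.sum_le_sum fun t _ => ?_).trans total
  have zero : ∀ i ∈ Finset.univ, i ∉ S →
      G.soleDeviation μ d (x t) i = 0 ∧ G.jointDeviation μ d (x t) i = 0 := fun i _ hi =>
    deviation_eq_zero (hS i hi (s i)) (G.entry_eq_one (hS i hi) (hx t i))
  have hsole := Finset.sum_subset (Finset.subset_univ S) fun i hi hi' => (zero i hi hi').1
  have hjoint := Finset.sum_subset (Finset.subset_univ S) fun i hi hi' => (zero i hi hi').2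
  have hJ : 0 ≤ ∑ i, G.jointDeviation μ d (x t) i :=
    Finset.sum_nonneg fun i _ => jointDeviation_nonneg hμ hdp (hx t) i
  -- Each player in `S` may lose the whole sum of joint deviations in utility. The resulting
  -- `S.card` copies are paid for by `P`, with at least `α` copies to spare because `α + S.card ≤
  -- P`.
  calc α * totalDeviation μ d (x t) ≤ ∑ i ∈ S, (-∑ k, G.jointDeviation μ d (x t) k +
        (α * G.soleDeviation μ d (x t) i + P * G.jointDeviation μ d (x t) i)) := by
        rw [Finset.sum_add_distrib, Finset.sum_add_distrib, ← Finset.mul_sum, ← Finset.mul_sum,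
          hsole, hjoint, Finset.sum_const, nsmul_eq_mul, totalDeviation_eq]
        have := mul_nonneg (sub_nonneg.2 hP) hJ
        linarith
    _ ≤ _ := Finset.sum_le_sum fun i _ => by
        have h₁ := util_deviation hμ s hN i (hx t)
        have h₂ := trajectoryPayment_deviation hμ s α P i (hx t)
        simp only [← hd] at h₁ h₂
        change _ ≤ G.util μ i (Function.update (x t) i (G.seqForm (s i))) at h₁
        change G.trajectoryPayment μ d α P i (Function.update (x t) i (G.seqForm (s i))) - _ = _
          at h₂
        linarith

theorem trajectory_steers (hμ : μ ∈ G.strategies none) (s : ∀ i, G.PureStrategy (some i))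
    (hN : G.IsNash μ fun i => G.seqForm (s i)) (S : Finset ι)
    (hS : ∀ i ∉ S, ∀ (r : G.PureStrategy (some i)) z, G.entry (G.seqForm r) z = 1)
    {Z Z' : ℝ} (hZ' : 1 ≤ Z') (hSZ' : S.card ≤ Z') (hZZ' : Z' ≤ Z)
    {T : ℕ} (hT : 0 < T) {R ε α P : ℝ} (hR : 0 < R) (hε : ε = R / T)
    (hα : α = 4 * √Z * ε ^ (1 / 4 : ℝ)) (hP : P = 2 * √Z * ε ^ (-(1 / 4) : ℝ)) (hα1 : α ≤ 1) :
    let d : G.Profile := fun i => G.seqForm (s i)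
    (0 ≤ α ∧ α ≤ P) ∧
    ∀ x : ℕ → G.Profile, (∀ t, x t ∈ G.profiles) →
      (∀ i, G.regret μ P (G.trajectoryPayment μ d α P) T x i ≤ R) →
      (∀ i, G.avgPayment (G.trajectoryPayment μ d α P) T x i ≤ 8 * Z' * √Z * ε ^ (1 / 4 : ℝ)) ∧
      G.outcomeGap μ d T x ≤ 2 * Z' * √ε := by
  intro d
  have hT' : (0 : ℝ) < T := by exact_mod_cast hT
  have hε0 : 0 < ε := by rw [hε]; positivity
  -- With w = ε^(1/4) and q = √Z everything becomes polynomial: ε = w⁴, √ε = w², α = 4qw and Pw =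
  -- 2q.
  have hw : 0 < ε ^ (1 / 4 : ℝ) := Real.rpow_pos_of_pos hε0 _
  have hw4 : ε = (ε ^ (1 / 4 : ℝ)) ^ 4 := by
    rw [← Real.rpow_natCast, ← Real.rpow_mul hε0.le]; norm_num
  have hsq : √ε = (ε ^ (1 / 4 : ℝ)) ^ 2 := by
    rw [Real.sqrt_eq_iff_mul_self_eq hε0.le (by positivity), ← pow_add]
    exact hw4
  rw [Real.rpow_neg hε0.le] at hP
  rw [hsq]
  generalize ε ^ (1 / 4 : ℝ) = w at *
  have hq1 : 1 ≤ √Z := by rw [Real.one_le_sqrt]; linarith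
  have hq2 : √Z * √Z = Z := Real.mul_self_sqrt (by linarith)
  generalize √Z = q at *
  have hq0 : 0 < q := by linarith
  have hα0 : 0 < α := by rw [hα]; positivity
  have hPw : P * w = 2 * q := by rw [hP]; field_simp
  -- From α ≤ 1 follows 4qw ≤ 1, so P = 2q/w ≥ 8q². This gives both `α + S.card ≤ P` and P + 1 ≤
  -- (9/8)P.
  have hP8 : 8 * Z ≤ P := by
    refine le_of_mul_le_mul_right ?_ hw
    rw [hPw, ← hq2]
    rw [hα] at hα1
    nlinarith
  have hm0 : (0 : ℝ) ≤ S.card := Nat.cast_nonneg _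
  have hP0 : 0 < P := by linarith
  refine ⟨⟨hα0.le, by linarith⟩, fun x hx hreg => ?_⟩
  have hdp : d ∈ G.profiles := seqForm_mem_profiles s
  have dev := sum_totalDeviation_le hμ s hN S hS hα0.le (by linarith) hx hreg
  change α * ∑ t ∈ Finset.range T, totalDeviation μ d (x t) ≤ _ at dev
  -- The constant is (9/8) P ε / α with P/α = 1/(2w²), that is (9/16) w².
  have avg : 1 / (T : ℝ) * ∑ t ∈ Finset.range T, totalDeviation μ d (x t) ≤
      9 / 16 * (Z' * w ^ 2) := by
    have h₁ : α * (1 / (T : ℝ) * ∑ t ∈ Finset.range T, totalDeviation μ d (x t)) ≤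
        S.card * ((P + 1) * ε) := by
      rw [mul_left_comm, one_div, inv_mul_le_iff₀ hT', hε]
      refine dev.trans_eq ?_
      field_simp
    have h₂ : (S.card : ℝ) * ((P + 1) * ε) ≤ Z' * (9 / 8 * P * ε) := by
      refine mul_le_mul hSZ' ?_ (by positivity) (by linarith)
      exact mul_le_mul_of_nonneg_right (by linarith) hε0.le
    refine le_of_mul_le_mul_left ((h₁.trans h₂).trans_eq ?_) hα0
    rw [hw4, hα]
    linear_combination 9 / 8 * Z' * w ^ 3 * hPw
  constructor
  · intro i
    unfold avgPayment
    have h₁ : ∑ t ∈ Finset.range T, G.trajectoryPayment μ d α P i (x t) ≤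
        ∑ t ∈ Finset.range T, (α + P * totalDeviation μ d (x t)) :=
      Finset.sum_le_sum fun t _ => trajectoryPayment_le hμ hdp hα0.le hP0.le i (hx t)
    rw [Finset.sum_add_distrib, Finset.sum_const, ← Finset.mul_sum, Finset.card_range,
      nsmul_eq_mul] at h₁
    refine (mul_le_mul_of_nonneg_left h₁ (by positivity)).trans ?_
    have h₂ : 1 / (T : ℝ) * (T * α) = α := by field_simp
    rw [mul_add, h₂, mul_left_comm]
    have h₃ := mul_le_mul_of_nonneg_left avg hP0.le
    have h₄ : P * (9 / 16 * (Z' * w ^ 2)) = 9 / 8 * (Z' * (q * w)) := by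
      linear_combination 9 / 16 * Z' * w * hPw
    have h₅ : q * w ≤ Z' * (q * w) := le_mul_of_one_le_left (by positivity) hZ'
    rw [hα]
    linarith
  · unfold outcomeGap
    calc _ ≤ ∑ z, 1 / (T : ℝ) * ∑ t ∈ Finset.range T, |G.reach μ (x t) z - G.reach μ d z| :=
          Finset.sum_le_sum fun z _ => abs_average_sub_le hT _ _ _ fun t => le_rfl
      _ = 1 / (T : ℝ) * ∑ t ∈ Finset.range T, ∑ z, |G.reach μ (x t) z - G.reach μ d z| := by
          rw [← Finset.mul_sum, Finset.sum_comm]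
      _ ≤ 1 / (T : ℝ) * ∑ t ∈ Finset.range T, 2 * totalDeviation μ d (x t) :=
          mul_le_mul_of_nonneg_left
            (Finset.sum_le_sum fun t _ => sum_abs_reach_sub_le hμ s (hx t)) (by positivity)
      _ ≤ _ := by
          rw [← Finset.mul_sum, mul_left_comm]
          have : 0 ≤ Z' * w ^ 2 := by positivity
          linarith

end Players

end ExtensiveGame

/-! ### Counting terminal nodes and players with a real choice. -/

namespace GameTree

variable {ι L : Type} {A : L → Type}

theorem finite_leaf [∀ I, Finite (A I)] (t : GameTree ι L A) : Finite t.Leaf :=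
  haveI : ∀ I, Fintype (A I) := fun I => Fintype.ofFinite (A I)
  (leafFintype t).finite

theorem card_leaf_chance [∀ I, Finite (A I)] (k : ℕ) (p : Fin k → ℝ)
    (c : Fin k → GameTree ι L A) :
    Nat.card (chance k p c).Leaf = ∑ a, Nat.card (c a).Leaf :=
  haveI := fun a => finite_leaf (c a)
  Nat.card_sigma

theorem card_leaf_decision [∀ I, Finite (A I)] (I : L) [Fintype (A I)]
    (c : A I → GameTree ι L A) :
    Nat.card (decision I c).Leaf = ∑ a, Nat.card (c a).Leaf :=
  haveI := fun a => finite_leaf (c a)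
  Nat.card_sigma

theorem card_leaf_pos [∀ I, Finite (A I)] [∀ I, Nonempty (A I)] (t : GameTree ι L A)
    (ht : t.WellFormed) : 0 < Nat.card t.Leaf :=
  haveI := finite_leaf t
  haveI := (exists_follow (fun I => Classical.arbitrary (A I)) t ht).nonempty
  Nat.card_pos

theorem arity_pos {k : ℕ} {p : Fin k → ℝ} {c : Fin k → GameTree ι L A}
    (ht : (chance k p c).WellFormed) : 0 < k := by
  rcases Nat.eq_zero_or_pos k with rfl | h
  · have := ht.2.1
    simp at this
  · exact h

open Classical in
/-- The players that have a decision with at least two actions. -/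
noncomputable def active [∀ I, Fintype (A I)] (owner : L → ι) : GameTree ι L A → Finset ι
  | leaf _ => ∅
  | chance _ _ c => Finset.univ.biUnion fun a => active owner (c a)
  | decision I c => (if Subsingleton (A I) then ∅ else {owner I}) ∪
      Finset.univ.biUnion fun a => active owner (c a)

/-- By induction every subtree has a terminal node to spare. A decision with at least two actions
joins at least two subtrees, and so has one spare node for its owner and one to keep. -/
theorem card_active_lt [∀ I, Fintype (A I)] [∀ I, Nonempty (A I)] (owner : L → ι)
    (t : GameTree ι L A) (ht : t.WellFormed) : (t.active owner).card < Nat.card t.Leaf := by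
  classical
  have key : ∀ {β : Type} [Fintype β] (c : β → GameTree ι L A),
      (∀ a, ((c a).active owner).card < Nat.card (c a).Leaf) →
      (Finset.univ.biUnion fun a => (c a).active owner).card + Fintype.card β ≤
        ∑ a, Nat.card (c a).Leaf := by
    intro β _ c h
    calc _ ≤ ∑ a, ((c a).active owner).card + ∑ _a : β, 1 := by
          refine Nat.add_le_add ?_ (by simp)
          convert Finset.card_biUnion_le
      _ = ∑ a, (((c a).active owner).card + 1) := Finset.sum_add_distrib.symm
      _ ≤ _ := Finset.sum_le_sum fun a _ => h a
  induction t with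
  | leaf u => exact card_leaf_pos _ ht
  | chance k p c ih =>
    have h := key c fun a => ih a (ht.2.2 a)
    have hk := arity_pos ht
    rw [card_leaf_chance]
    simp only [active, Fintype.card_fin] at h ⊢
    omega
  | decision I c ih =>
    have h := key c fun a => ih a (ht a)
    rw [card_leaf_decision]
    have h₁ : (if Subsingleton (A I) then ∅ else {owner I} : Finset ι).card <
        Fintype.card (A I) := by
      split_ifs with hs
      · exact Fintype.card_pos
      · rw [Finset.card_singleton, Fintype.one_lt_card_iff_nontrivial]
        exact not_subsingleton_iff_nontrivial.1 hs
    have h₂ := Finset.card_union_le (if Subsingleton (A I) then ∅ else {owner I} : Finset ι)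
      (Finset.univ.biUnion fun a => (c a).active owner)
    simp only [active]
    omega

end GameTree

namespace ExtensiveGame

variable {ι : Type} [DecidableEq ι] (G : ExtensiveGame ι)

instance finite_augAction (I : G.AugInfoSet) : Finite (G.AugAction I) := by
  cases I with
  | mediator _ I => exact inferInstanceAs (Finite (G.Action I))
  | player I _ _ => exact inferInstanceAs (Finite (G.Action I))

variable {advise : List ι → ι → Prop} {I : G.InfoSet}
  {c : G.Action I → GameTree ι G.InfoSet G.Action} {history : List G.AugEvent}
  {past : ι → List (Option (Σ J, G.Action J))} {dis : List ι}

open Classical in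
theorem augTree_of_advise (h : advise dis (G.owner I)) :
    G.augTree advise (.decision I c) history past dis =
      .decision (.mediator history I) fun r : G.Action I =>
        .decision (.player I (past (G.owner I)) (some r)) fun a : G.Action I =>
          G.augTree advise (c a) (.act I a :: .advice I r :: history)
            (Function.update past (G.owner I) (some ⟨I, r⟩ :: past (G.owner I)))
            (if a = r then dis else G.owner I :: dis) := by
  rw [augTree, if_pos h]

theorem augTree_of_not_advise (h : ¬ advise dis (G.owner I)) :
    G.augTree advise (.decision I c) history past dis =
      .decision (.player I (past (G.owner I)) none) fun a : G.Action I =>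
        G.augTree advise (c a) (.act I a :: history)
          (Function.update past (G.owner I) (none :: past (G.owner I))) dis := by
  rw [augTree, if_neg h]

open Classical in
theorem card_augTree_of_advise (h : advise dis (G.owner I)) :
    Nat.card (G.augTree advise (.decision I c) history past dis).Leaf =
      ∑ r : G.Action I, ∑ a : G.Action I,
        Nat.card (G.augTree advise (c a) (.act I a :: .advice I r :: history)
            (Function.update past (G.owner I) (some ⟨I, r⟩ :: past (G.owner I)))
            (if a = r then dis else G.owner I :: dis)).Leaf := by
  rw [augTree_of_advise G h]
  let : Fintype (G.AugAction (.mediator history I)) := inferInstanceAs (Fintype (G.Action I))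
  refine (GameTree.card_leaf_decision _ _).trans (Finset.sum_congr rfl fun r _ => ?_)
  let : Fintype (G.AugAction (.player I (past (G.owner I)) (some r))) :=
    inferInstanceAs (Fintype (G.Action I))
  exact GameTree.card_leaf_decision _ _

theorem card_augTree_of_not_advise (h : ¬ advise dis (G.owner I)) :
    Nat.card (G.augTree advise (.decision I c) history past dis).Leaf =
      ∑ a : G.Action I, Nat.card (G.augTree advise (c a) (.act I a :: history)
          (Function.update past (G.owner I) (none :: past (G.owner I))) dis).Leaf := by
  rw [augTree_of_not_advise G h]
  let : Fintype (G.AugAction (.player I (past (G.owner I)) none)) :=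
    inferInstanceAs (Fintype (G.Action I))
  exact GameTree.card_leaf_decision _ _

theorem sum_le_sum_pow {β : Type*} [Fintype β] (m f : β → ℕ) (k : ℕ)
    (h : ∀ a, f a ≤ m a ^ (k + 1)) : ∑ a, f a ≤ (∑ a, m a) ^ (k + 1) := by
  rw [pow_succ, Finset.mul_sum]
  refine Finset.sum_le_sum fun a ha => (h a).trans ?_
  rw [pow_succ]
  exact Nat.mul_le_mul_right _ (Nat.pow_le_pow_left (Finset.single_le_sum (by simp) ha) k)

/-- The number of terminal nodes below a node at which at most `k` more recommendations can be
disobeyed before the mediator stops giving recommendations. -/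
theorem card_augTree_le
    (hadvise : ∀ (dis : List ι) (i : ι), 2 ≤ dis.length → ¬ advise dis i) :
    ∀ (t : GameTree ι G.InfoSet G.Action), t.WellFormed →
      ∀ (history : List G.AugEvent) (past : ι → List (Option (Σ J, G.Action J))) (dis : List ι)
        (k : ℕ), 2 ≤ dis.length + k →
        Nat.card (G.augTree advise t history past dis).Leaf ≤ Nat.card t.Leaf ^ (k + 1) := by
  intro t
  induction t with
  | leaf u =>
    intro _ history past dis k _
    have h₁ : Nat.card (GameTree.leaf u : GameTree ι G.InfoSet G.Action).Leaf = 1 :=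
      Nat.card_unique (α := Unit)
    have h₂ : Nat.card (G.augTree advise (.leaf u) history past dis).Leaf = 1 :=
      Nat.card_unique (α := Unit)
    rw [h₁, h₂, one_pow]
  | chance n p c ih =>
    intro ht history past dis k hk
    rw [augTree, GameTree.card_leaf_chance, GameTree.card_leaf_chance]
    exact sum_le_sum_pow _ _ k fun a => ih a (ht.2.2 a) _ _ _ k hk
  | decision I c ih =>
    intro ht history past dis k hk
    rw [GameTree.card_leaf_decision]
    by_cases h : advise dis (G.owner I)
    · rw [card_augTree_of_advise G h]
      have hdis : dis.length < 2 := by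
        by_contra h'
        exact hadvise dis _ (not_lt.1 h') h
      -- A recommendation is given here, so fewer than two were disobeyed and the budget is
      -- positive.
      obtain ⟨k, rfl⟩ : ∃ k', k = k' + 1 := ⟨k - 1, by omega⟩
      -- With m_a the size of the subtree at `a` and M their sum, the term for recommendation `r`
      -- and action `a` is bounded by M^k m_a m_r. Obedience (`a = r`) keeps the budget and uses
      -- both factors; disobedience lowers it by one and needs only m_r ≥ 1.
      rw [pow_succ, pow_succ, Finset.mul_sum]
      refine Finset.sum_le_sum fun r _ => ?_
      rw [Finset.mul_sum, Finset.sum_mul]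
      refine Finset.sum_le_sum fun a ha => ?_
      have hpos := GameTree.card_leaf_pos _ (ht r)
      have hle : Nat.card (c a).Leaf ≤ ∑ a, Nat.card (c a).Leaf :=
        Finset.single_le_sum (f := fun a => Nat.card (c a).Leaf) (by simp) ha
      have hpow : Nat.card (c a).Leaf ^ (k + 1) ≤
          (∑ a, Nat.card (c a).Leaf) ^ k * Nat.card (c a).Leaf := by
        rw [pow_succ]
        exact Nat.mul_le_mul_right _ (Nat.pow_le_pow_left hle k)
      by_cases hr : a = r
      · rw [if_pos hr]
        refine (ih a (ht a) _ _ _ (k + 1) hk).trans ?_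
        rw [pow_succ, ← hr]
        exact Nat.mul_le_mul_right _ hpow
      · rw [if_neg hr]
        refine (ih a (ht a) _ _ _ k (by simp; omega)).trans (hpow.trans ?_)
        exact Nat.le_mul_of_pos_right _ hpos
    · rw [card_augTree_of_not_advise G h]
      exact sum_le_sum_pow _ _ k fun a => ih a (ht a) _ _ _ k hk

/-- It suffices to keep one arbitrary recommendation at each node where one is given. -/
theorem card_le_card_augTree :
    ∀ (t : GameTree ι G.InfoSet G.Action)
      (history : List G.AugEvent) (past : ι → List (Option (Σ J, G.Action J))) (dis : List ι),
        Nat.card t.Leaf ≤ Nat.card (G.augTree advise t history past dis).Leaf := by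
  intro t
  induction t with
  | leaf u => intro history past dis; exact le_rfl
  | chance n p c ih =>
    intro history past dis
    rw [augTree, GameTree.card_leaf_chance, GameTree.card_leaf_chance]
    exact Finset.sum_le_sum fun a _ => ih a _ _ _
  | decision I c ih =>
    intro history past dis
    rw [GameTree.card_leaf_decision]
    by_cases h : advise dis (G.owner I)
    · rw [card_augTree_of_advise G h]
      refine le_trans ?_ (Finset.single_le_sum (by simp)
        (Finset.mem_univ (Classical.arbitrary (G.Action I))))
      exact Finset.sum_le_sum fun a _ => ih a _ _ _
    · rw [card_augTree_of_not_advise G h]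
      exact Finset.sum_le_sum fun a _ => ih a _ _ _

/-- Moves of the mediator are not moves of `i`, and at each decision of `i` the only action
available is the one that `f` prescribes. -/
theorem agree_augTree_of_not_active {i : ι} (f : ∀ I, G.AugAction I) :
    ∀ (t : GameTree ι G.InfoSet G.Action), i ∉ t.active G.owner →
      ∀ (history : List G.AugEvent) (past : ι → List (Option (Σ J, G.Action J))) (dis : List ι)
        (z : (G.augTree advise t history past dis).Leaf),
        GameTree.agree G.augOwner (some i) f (G.augTree advise t history past dis) z = 1 := by
  intro t
  induction t with
  | leaf u => intro _ history past dis z; exact GameTree.agree_leaf _ _ _ _ _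
  | chance n p c ih =>
    rintro hi history past dis ⟨a, z⟩
    simp only [GameTree.active, Finset.mem_biUnion, Finset.mem_univ, true_and, not_exists] at hi
    exact ih a (hi a) _ _ _ z
  | decision I c ih =>
    intro hi history past dis
    simp only [GameTree.active, Finset.mem_union, Finset.mem_biUnion, Finset.mem_univ, true_and,
      not_or, not_exists] at hi
    have hsub : G.owner I = i → Subsingleton (G.Action I) := by
      rintro rfl
      by_contra h
      exact hi.1 (by simp [h])
    by_cases h : advise dis (G.owner I)
    · rw [augTree_of_advise G h]
      rintro ⟨r, a, z⟩
      refine (GameTree.agree_decision _ _ _ _ _ _ _).trans ?_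
      rw [if_neg (by rintro ⟨h, -⟩; simp [augOwner] at h)]
      refine (GameTree.agree_decision _ _ _ _ _ _ _).trans ?_
      rw [if_neg]
      · exact ih a (hi.2 a) _ _ _ z
      · rintro ⟨h₁, h₂⟩
        exact h₂ ((hsub (Option.some.inj h₁)).elim (α := G.Action I) _ _)
    · rw [augTree_of_not_advise G h]
      rintro ⟨a, z⟩
      refine (GameTree.agree_decision _ _ _ _ _ _ _).trans ?_
      rw [if_neg]
      · exact ih a (hi.2 a) _ _ _ z
      · rintro ⟨h₁, h₂⟩
        exact h₂ ((hsub (Option.some.inj h₁)).elim (α := G.Action I) _ _)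

theorem entry_augment_of_not_active {i : ι} (hi : i ∉ G.tree.active G.owner)
    (r : (G.augment advise).PureStrategy (some i)) (z : (G.augment advise).Terminal) :
    (G.augment advise).entry ((G.augment advise).seqForm r) z = 1 := by
  classical
  have h := (G.augment advise).entry_eq_agree r
    (fun I => if h : (G.augment advise).owner I = some i then r ⟨I, h⟩ else Classical.arbitrary _)
    (fun I h => dif_pos h) z
  exact h.trans (G.agree_augTree_of_not_active _ G.tree hi _ _ _ z)

end ExtensiveGame

/-! ### Finite-horizon bounds and their limits. -/

theorem mainTheorem6 {n : ℕ} (G : ExtensiveGame (Fin n))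
    (advise : List (Fin n) → Fin n → Prop)
    (μ : (G.augment advise).Seq none → ℝ)
    (s : ∀ i : Fin n, (G.augment advise).PureStrategy (some i))
    (hs : ∀ i, G.IsDirect advise (s i))
    (hμ : G.IsBayesCorrelatedEquilibrium advise μ
      fun i => (G.augment advise).seqForm (s i)) :
    let Γ := G.augment advise
    let d : Γ.Profile := fun i => Γ.seqForm (s i)
    let Z : ℝ := Fintype.card Γ.Terminal
    let Z' : ℝ := Fintype.card G.Terminal
    -- size of the augmented game
    ((∀ (dis : List (Fin n)) (i : Fin n), 2 ≤ dis.length → ¬ advise dis i) → Z ≤ Z' ^ 3) ∧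
    -- FullFeedbackSteer, finite horizon
    (∀ (T : ℕ) (R : ℝ) (x : ℕ → Γ.Profile), 0 < T → 0 < R →
      let ε : ℝ := 4 * n * R / T
      let α : ℝ := √ε
      let p := Γ.fullFeedbackPayment μ d α
      α ≤ 1 / Z →
      (∀ i, Γ.IsPaymentFunction 3 i (p i)) ∧
      ((∀ t, x t ∈ Γ.profiles) → (∀ i, Γ.regret μ 3 p T x i ≤ R) →
        (∀ i, Γ.avgPayment p T x i ≤ 3 * Z * √ε) ∧
        Γ.directnessGap d T x ≤ 3 * Z * √ε ∧
        Γ.outcomeGap μ d T x ≤ 3 * Z * √ε)) ∧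
    -- FullFeedbackSteer, asymptotics
    (∀ (R : ℕ → ℝ) (x : ℕ → ℕ → Γ.Profile), (∀ T, 0 < R T) →
      Filter.Tendsto (fun T : ℕ => R T / T) Filter.atTop (nhds 0) →
      let p : ℕ → Fin n → Γ.Profile → ℝ := fun T =>
        Γ.fullFeedbackPayment μ d √(4 * n * R T / T)
      (∀ T t, x T t ∈ Γ.profiles) →
      (∀ᶠ T in Filter.atTop, ∀ i, Γ.regret μ 3 (p T) T (x T) i ≤ R T) →
      (∀ i, Filter.Tendsto (fun T => Γ.avgPayment (p T) T (x T) i) Filter.atTop (nhds 0)) ∧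
      Filter.Tendsto (fun T => Γ.directnessGap d T (x T)) Filter.atTop (nhds 0) ∧
      Filter.Tendsto (fun T => Γ.outcomeGap μ d T (x T)) Filter.atTop (nhds 0)) ∧
    -- TrajectorySteer, finite horizon
    (∀ (T : ℕ) (R : ℝ) (x : ℕ → Γ.Profile), 0 < T → 0 < R →
      let ε : ℝ := R / T
      let α : ℝ := 4 * √Z * ε ^ (1 / 4 : ℝ)
      let P : ℝ := 2 * √Z * ε ^ (-(1 / 4) : ℝ)
      let p := Γ.trajectoryPayment μ d α P
      α ≤ 1 →
      (∀ i z, 0 ≤ Γ.trajectoryPay d α P i z ∧ Γ.trajectoryPay d α P i z ≤ P) ∧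
      ((∀ t, x t ∈ Γ.profiles) → (∀ i, Γ.regret μ P p T x i ≤ R) →
        (∀ i, Γ.avgPayment p T x i ≤ 8 * Z' * √Z * ε ^ (1 / 4 : ℝ)) ∧
        Γ.outcomeGap μ d T x ≤ 2 * Z' * √ε)) ∧
    -- TrajectorySteer, asymptotics
    (∀ (R : ℕ → ℝ) (x : ℕ → ℕ → Γ.Profile), (∀ T, 0 < R T) →
      Filter.Tendsto (fun T : ℕ => R T / T) Filter.atTop (nhds 0) →
      let α : ℕ → ℝ := fun T => 4 * √Z * (R T / T) ^ (1 / 4 : ℝ)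
      let P : ℕ → ℝ := fun T => 2 * √Z * (R T / T) ^ (-(1 / 4) : ℝ)
      let p : ℕ → Fin n → Γ.Profile → ℝ := fun T => Γ.trajectoryPayment μ d (α T) (P T)
      (∀ T t, x T t ∈ Γ.profiles) →
      (∀ᶠ T in Filter.atTop, ∀ i, Γ.regret μ (P T) (p T) T (x T) i ≤ R T) →
      (∀ i, Filter.Tendsto (fun T => Γ.avgPayment (p T) T (x T) i) Filter.atTop (nhds 0)) ∧
      Filter.Tendsto (fun T => Γ.outcomeGap μ d T (x T)) Filter.atTop (nhds 0)) := by
  intro Γ d Z Z'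
  obtain ⟨hμ, hN⟩ := hμ
  have hZcard : Z = Nat.card (G.augTree advise G.tree [] (fun _ => []) []).Leaf := by
    simp only [Z, ← Nat.card_eq_fintype_card]; rfl
  have hZ'card : Z' = Nat.card G.tree.Leaf := by
    simp only [Z', ← Nat.card_eq_fintype_card]; rfl
  have hZ' : 1 ≤ Z' := by
    rw [hZ'card]; exact_mod_cast GameTree.card_leaf_pos _ G.wellFormed
  have hZZ' : Z' ≤ Z := by
    rw [hZ'card, hZcard]; exact_mod_cast G.card_le_card_augTree _ _ _ _
  have hZ : 0 < Z := by linarith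
  have hS : ((G.tree.active G.owner).card : ℝ) ≤ Z' := by
    rw [hZ'card]; exact_mod_cast (GameTree.card_active_lt G.owner _ G.wellFormed).le
  have full : ∀ (T : ℕ) (R : ℝ) (x : ℕ → Γ.Profile), 0 < T → 0 < R →
      √(4 * n * R / T) ≤ 1 / Z →
      (∀ i, Γ.IsPaymentFunction 3 i (Γ.fullFeedbackPayment μ d √(4 * n * R / T) i)) ∧
      ((∀ t, x t ∈ Γ.profiles) →
        (∀ i, Γ.regret μ 3 (Γ.fullFeedbackPayment μ d √(4 * n * R / T)) T x i ≤ R) →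
        (∀ i, Γ.avgPayment (Γ.fullFeedbackPayment μ d √(4 * n * R / T)) T x i ≤
          3 * Z * √(4 * n * R / T)) ∧
        Γ.directnessGap d T x ≤ 3 * Z * √(4 * n * R / T) ∧
        Γ.outcomeGap μ d T x ≤ 3 * Z * √(4 * n * R / T)) := by
    intro T R x hT hR hα
    exact ⟨ExtensiveGame.isPaymentFunction_fullFeedbackPayment hμ (Real.sqrt_nonneg _) hα,
      fun hx hreg => ExtensiveGame.fullFeedback_steers hμ s hN hT hR hx (by simp) hα hreg⟩
  have traj := fun (T : ℕ) (R : ℝ) (hT : 0 < T) (hR : 0 < R) =>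
    ExtensiveGame.trajectory_steers hμ s hN (G.tree.active G.owner)
      (fun i hi r z => G.entry_augment_of_not_active hi r z) hZ' hS hZZ' hT hR rfl rfl rfl
  refine ⟨fun h => ?_, full, ?_, ?_, ?_⟩
  · rw [hZcard, hZ'card]
    -- At the root nothing has been disobeyed, so the budget is 2 and the exponent 3.
    exact_mod_cast G.card_augTree_le h G.tree G.wellFormed _ _ [] 2 le_rfl
  · intro R x hR hlim p hx hreg
    have hlim' : Filter.Tendsto (fun T : ℕ => √(4 * n * R T / T)) Filter.atTop (nhds 0) := by
      have := (hlim.const_mul (4 * n : ℝ)).sqrt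
      simpa only [mul_zero, Real.sqrt_zero, mul_div_assoc] using this
    have hbound : Filter.Tendsto (fun T : ℕ => 3 * Z * √(4 * n * R T / T)) Filter.atTop
        (nhds 0) := by
      simpa only [mul_zero] using hlim'.const_mul (3 * Z)
    -- Since `α` tends to 0, the finite-horizon hypothesis `α ≤ 1 / Z` holds for all large `T`. The
    -- payment property is kept because the squeeze below needs nonnegative payments.
    have ev : ∀ᶠ T : ℕ in Filter.atTop, (∀ i, Γ.IsPaymentFunction 3 i (p T i)) ∧
        (∀ i, Γ.avgPayment (p T) T (x T) i ≤ 3 * Z * √(4 * n * R T / T)) ∧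
        Γ.directnessGap d T (x T) ≤ 3 * Z * √(4 * n * R T / T) ∧
        Γ.outcomeGap μ d T (x T) ≤ 3 * Z * √(4 * n * R T / T) := by
      filter_upwards [hreg, Filter.eventually_gt_atTop 0,
        hlim'.eventually_le_const (one_div_pos.2 hZ)] with T h₁ h₂ h₃
      have := full T (R T) (x T) h₂ (hR T) h₃
      exact ⟨this.1, this.2 (hx T) h₁⟩
    refine ⟨fun i => squeeze_zero' ?_ (ev.mono fun T h => h.2.1 i) hbound,
      squeeze_zero' (.of_forall fun T => Finset.sum_nonneg fun z _ => abs_nonneg _)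
        (ev.mono fun T h => h.2.2.1) hbound,
      squeeze_zero' (.of_forall fun T => Finset.sum_nonneg fun z _ => abs_nonneg _)
        (ev.mono fun T h => h.2.2.2) hbound⟩
    filter_upwards [ev] with T h
    exact mul_nonneg (by positivity) (Finset.sum_nonneg fun t _ => (h.1 i).nonneg _ (hx T t))
  · intro T R x hT hR ε α P p hα
    obtain ⟨⟨h₁, h₂⟩, h₃⟩ := traj T R hT hR hα
    exact ⟨ExtensiveGame.trajectoryPay_mem s h₁ h₂, h₃ x⟩
  · intro R x hR hlim α P p hx hreg
    have hα : Filter.Tendsto α Filter.atTop (nhds 0) := by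
      have := (hlim.rpow_const (p := 1 / 4) (Or.inr (by norm_num))).const_mul (4 * √Z)
      rwa [Real.zero_rpow (by norm_num), mul_zero] at this
    have hpay : Filter.Tendsto (fun T : ℕ => 8 * Z' * √Z * (R T / T) ^ (1 / 4 : ℝ)) Filter.atTop
        (nhds 0) := by
      have := (hlim.rpow_const (p := 1 / 4) (Or.inr (by norm_num))).const_mul (8 * Z' * √Z)
      rwa [Real.zero_rpow (by norm_num), mul_zero] at this
    have hgap : Filter.Tendsto (fun T : ℕ => 2 * Z' * √(R T / T)) Filter.atTop (nhds 0) := by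
      simpa only [mul_zero, Real.sqrt_zero] using hlim.sqrt.const_mul (2 * Z')
    have ev : ∀ᶠ T : ℕ in Filter.atTop, (0 ≤ α T ∧ α T ≤ P T) ∧
        (∀ i, Γ.avgPayment (p T) T (x T) i ≤ 8 * Z' * √Z * (R T / T) ^ (1 / 4 : ℝ)) ∧
        Γ.outcomeGap μ d T (x T) ≤ 2 * Z' * √(R T / T) := by
      filter_upwards [hreg, Filter.eventually_gt_atTop 0,
        hα.eventually_le_const one_pos] with T h₁ h₂ h₃
      have := traj T (R T) h₂ (hR T) h₃
      exact ⟨this.1, this.2 (x T) (hx T) h₁⟩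
    refine ⟨fun i => squeeze_zero' ?_ (ev.mono fun T h => h.2.1 i) hpay,
      squeeze_zero' (.of_forall fun T => Finset.sum_nonneg fun z _ => abs_nonneg _)
        (ev.mono fun T h => h.2.2) hgap⟩
    filter_upwards [ev] with T h
    exact mul_nonneg (by positivity) (Finset.sum_nonneg fun t _ =>
      ExtensiveGame.trajectoryPayment_nonneg hμ s h.1.1 h.1.2 i (hx T t))
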